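/- For an oriented link diagram $D$ let $s_0D$ be the collection of circles obtained by giving every crossing its $0$-smoothing (at a positive crossing this is the orientation-preserving, or Seifert, smoothing), and let $G_0(D)$ be the multigraph whose vertices are the circles of $s_0D$ and which has one edge for each crossing, joining the circles of the two arcs of the smoothing at that crossing; for a positive diagram (one without negative crossings) this is the Seifert graph. For a multigraph $G$ let $G^{red}$ be the graph obtained from $G$ by identifying parallel edges (edges with the same pair of ends). A diagram is reduced if it has no nugatory crossing, i.e. no crossing at which two opposite corners belong to the same face of the diagram. Let $Kh^i(D)$ denote the integral Khovanov homology group of $D$ in homological degree $i$, summed over all quantum degrees (the quantum grading is disregarded). Let $D$ be a reduced positive diagram of a link $L$, and let $D'$ be a positive diagram of a link $L'$ such that $G_0(D')\cong G_0(D)^{red}$ as graphs. Then $Kh^1(D)\cong Kh^1(D')$ as abelian groups; that is, $Kh^1(L)\cong Kh^1(L')$, where the Khovanov homology groups of $L$ and $L'$ are computed from the diagrams $D$ and $D'$. -/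

import Mathlib

/-! ### Multigraphs: parallel edges and isomorphisms -/

/-- The reduced graph of a multigraph: parallel edges (edges with the same ends) are identified, so
there is one edge, labelled by the unordered pair `{x, y}`, for each pair of adjacent vertices. -/
def Graph.reduced {α β : Type*} (G : Graph α β) : Graph α (Sym2 α) where
  vertexSet := G.vertexSet
  IsLink e x y := e = s(x, y) ∧ G.Adj x y
  isLink_symm := by
    refine fun e _ => ⟨?_⟩
    rintro x y ⟨rfl, h⟩
    exact ⟨Sym2.eq_swap, h.symm⟩
  eq_or_eq_of_isLink_of_isLink := by
    rintro e x y v w ⟨rfl, _⟩ ⟨h, _⟩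
    rw [Sym2.eq_iff] at h
    tauto
  left_mem_of_isLink := by
    rintro e x y ⟨_, h⟩
    exact h.left_mem

/-- Isomorphisms of multigraphs: bijections on vertices and on edges that respect incidence. -/
structure Graph.MultiIso {α β α' β' : Type*} (G : Graph α β) (H : Graph α' β') where
  vertexEquiv : G.vertexSet ≃ H.vertexSet
  edgeEquiv : G.edgeSet ≃ H.edgeSet
  isLink_iff : ∀ (e : G.edgeSet) (x y : G.vertexSet),
    G.IsLink e x y ↔ H.IsLink (edgeEquiv e) (vertexEquiv x) (vertexEquiv y)

/-! ### Oriented link diagrams -/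

/-- Counterclockwise rotation about a crossing. The four half-edges at the crossing `c` are
`(c, 0), (c, 1), (c, 2), (c, 3)`, in counterclockwise order. -/
def rotateHalfEdge (n : ℕ) : Equiv.Perm (Fin n × Fin 4) :=
  Equiv.prodCongr (Equiv.refl _) (Equiv.addRight 1)

/-- Whether the half-edge in position `i` of a crossing points away from the crossing. Position `0`
is the incoming end of the lower strand, so position `2` is its outgoing end; the upper strand runs
from position `3` to position `1` at a positive crossing and from `1` to `3` at a negative one. -/
def isOutgoing (positive : Bool) (i : Fin 4) : Prop :=
  i = 2 ∨ i = if positive then 1 else 3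

/-- The permutation of the half-edges whose cycles are the boundaries of the faces: follow the edge
to its other end, then take the next half-edge in clockwise order. The face of `h` is the one that
contains the corner between `h` and the counterclockwise next half-edge. -/
def facePermutation {n : ℕ} (glue : Equiv.Perm (Fin n × Fin 4)) : Equiv.Perm (Fin n × Fin 4) :=
  (rotateHalfEdge n)⁻¹ * glue

/-- The equivalence relation of lying in the same connected component of the underlying
four-valent graph. -/
def connectedSetoid {n : ℕ} (glue : Equiv.Perm (Fin n × Fin 4)) : Setoid (Fin n × Fin 4) :=
  Relation.EqvGen.setoid fun a b => b = glue a ∨ b = rotateHalfEdge n a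

/-- An oriented link diagram with ordered crossings, as an oriented plane four-valent graph with
crossing information, together with a number of circles without crossings. The four half-edges at a
crossing are numbered counterclockwise, beginning with the incoming end of the lower strand (a planar
diagram code). How the connected components of the diagram are placed in the faces of one
another is not recorded. -/
structure LinkDiagram where
  /-- the number of crossings -/
  n : ℕ
  /-- the number of components that are circles without crossings -/
  loops : ℕ
  /-- whether a crossing is positive -/
  positive : Fin n → Bool
  /-- sends each half-edge to the other half of the same edge -/
  glue : Equiv.Perm (Fin n × Fin 4)
  glue_glue : ∀ h, glue (glue h) = h
  /-- every edge leads from an outgoing half-edge to an incoming one -/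
  oriented : ∀ h, isOutgoing (positive (glue h).1) (glue h).2 ↔ ¬ isOutgoing (positive h.1) h.2
  /-- The diagram is planar: Euler's formula `V - E + F = 2 C`, with `V = n` crossings, `E = 2 n`
  edges, `F` faces and `C` connected components (each on a sphere of its own). -/
  planar : Nat.card (Quotient (Equiv.Perm.SameCycle.setoid (facePermutation glue))) =
    n + 2 * Nat.card (Quotient (connectedSetoid glue))

noncomputable section

namespace LinkDiagram

variable (D : LinkDiagram)

/-- A half-edge is given by a crossing and a position at that crossing. -/
abbrev HalfEdge : Type := Fin D.n × Fin 4

/-- A diagram is positive if it has no negative crossings. -/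
def IsPositive : Prop := ∀ c, D.positive c = true

/-- The number of negative crossings. -/
def numNegative : ℕ := (Finset.univ.filter fun c => D.positive c = false).card

/-- A crossing is nugatory if two opposite corners at it belong to the same face, that is, if some
circle in the plane meets the diagram only in this crossing, passing through it from one corner to
the opposite one. -/
def IsNugatory (c : Fin D.n) : Prop :=
  ∃ i : Fin 4, (facePermutation D.glue).SameCycle (c, i) (c, i + 2)

/-- A diagram is reduced if it has no nugatory crossings. -/
def IsReduced : Prop := ∀ c, ¬ D.IsNugatory c

/-! ### States, resolutions and state graphs -/

/-- A state assigns a marker to every crossing: `false` is the marker `0`, `true` the marker `1`. -/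
abbrev State : Type := Fin D.n → Bool

/-- The state with the marker `0` at every crossing. -/
def zeroState : D.State := fun _ => false

/-- The number of markers `1` of a state. -/
def weight (s : D.State) : ℕ := (Finset.univ.filter fun c => s c = true).card

/-- The smoothing of a crossing: the marker `0` joins position `0` to `1` and `2` to `3`,
the marker `1` joins position `0` to `3` and `1` to `2`. -/
def smooth (s : D.State) (h : D.HalfEdge) : D.HalfEdge :=
  (h.1, if s h.1 then ![3, 2, 1, 0] h.2 else ![1, 0, 3, 2] h.2)

/-- The equivalence relation of lying on the same circle of the resolution. -/
def circleSetoid (s : D.State) : Setoid D.HalfEdge :=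
  Relation.EqvGen.setoid fun a b => b = D.glue a ∨ b = D.smooth s a

/-- The circles of the resolution `sD`. -/
abbrev Circle (s : D.State) : Type := Quotient (D.circleSetoid s) ⊕ Fin D.loops

/-- The circle of the resolution `sD` through a half-edge. -/
def circleOf (s : D.State) (h : D.HalfEdge) : D.Circle s := Sum.inl (Quotient.mk _ h)

/-- The state graph: its vertices are the circles of `sD`, and every crossing `c` gives an edge, the
chord between the two arcs of the smoothing at `c` (under both smoothings, the positions `0` and
`2` lie on different arcs). -/
def stateGraph (s : D.State) : Graph (D.Circle s) (Fin D.n) where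
  vertexSet := Set.univ
  IsLink c x y := s(x, y) = s(D.circleOf s (c, 0), D.circleOf s (c, 2))
  isLink_symm := by
    refine fun c _ => ⟨fun x y h => ?_⟩
    rw [Sym2.eq_swap]
    exact h
  eq_or_eq_of_isLink_of_isLink := by
    intro c x y v w h h'
    have h2 := h.trans h'.symm
    rw [Sym2.eq_iff] at h2
    tauto
  left_mem_of_isLink := fun _ _ _ _ => Set.mem_univ _

/-! ### Khovanov homology -/

instance (s : D.State) : Fintype (D.Circle s) := Fintype.ofFinite _

instance (s : D.State) : DecidableEq (D.Circle s) := Classical.decEq _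

/-- The labellings of the circles of `sD` by `v₊` (`true`) and `v₋` (`false`). -/
abbrev Labelling (s : D.State) : Type := D.Circle s → Bool

/-- The group `V_s = V^{⊗ |sD|}`, where `V` is free on `v₊` and `v₋`: the free abelian group on the
labellings of the circles, a labelling being the tensor product of its labels. -/
abbrev VertexGroup (s : D.State) : Type := D.Labelling s → ℤ

/-- The coefficient of `z` in the product `m (x ⊗ y)`, where `m (v₊ ⊗ v₊) = v₊`,
`m (v₊ ⊗ v₋) = m (v₋ ⊗ v₊) = v₋` and `m (v₋ ⊗ v₋) = 0`. -/
def mulCoeff : Bool → Bool → Bool → ℤ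
  | true, true, true => 1
  | true, false, false => 1
  | false, true, false => 1
  | _, _, _ => 0

/-- The coefficient of `x ⊗ y` in the coproduct `Δ z`, where `Δ v₊ = v₊ ⊗ v₋ + v₋ ⊗ v₊` and
`Δ v₋ = v₋ ⊗ v₋`. -/
def comulCoeff : Bool → Bool → Bool → ℤ
  | true, true, false => 1
  | true, false, true => 1
  | false, false, false => 1
  | _, _, _ => 0

/-- Labellings of the circles of `sD` and `tD` agree on the crossingless components and on all the
circles of `sD` that do not pass by the crossing `k`. -/
def AgreeAway (s t : D.State) (k : Fin D.n) (x : D.Labelling s) (y : D.Labelling t) : Prop :=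
  (∀ i : Fin D.loops, x (Sum.inr i) = y (Sum.inr i)) ∧
  ∀ h : D.HalfEdge, D.circleOf s h ≠ D.circleOf s (k, 0) → D.circleOf s h ≠ D.circleOf s (k, 2) →
    x (D.circleOf s h) = y (D.circleOf t h)

open Classical in
/-- The coefficient of the labelling `y` in the image of the labelling `x` under the map of the edge
of the cube from `s` to `t`, where `t` arises from `s` by changing the marker at `k` from `0` to `1`.
If two different circles of `sD` pass by `k`, they merge into one circle of `tD`; otherwise
the circle of `sD` at `k` splits into two circles of `tD`. -/
def edgeCoeff (s t : D.State) (k : Fin D.n) (x : D.Labelling s) (y : D.Labelling t) : ℤ :=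
  if D.AgreeAway s t k x y then
    if D.circleOf s (k, 0) ≠ D.circleOf s (k, 2) then
      mulCoeff (x (D.circleOf s (k, 0))) (x (D.circleOf s (k, 2))) (y (D.circleOf t (k, 0)))
    else
      comulCoeff (x (D.circleOf s (k, 0))) (y (D.circleOf t (k, 0))) (y (D.circleOf t (k, 2)))
  else 0

/-- The map `V_s → V_t` of the edge of the cube from `s` to `t` that changes the marker at `k`. -/
def edgeMap (s t : D.State) (k : Fin D.n) : D.VertexGroup s →ₗ[ℤ] D.VertexGroup t :=
  Matrix.mulVecLin (Matrix.of fun y x => D.edgeCoeff s t k x y)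

/-- The states with exactly `r` markers `1`. -/
abbrev StateOfWeight (r : ℤ) : Type := {s : D.State // (D.weight s : ℤ) = r}

/-- The chain group in degree `r`: the direct sum of the groups `V_s` over the states `s` with `r`
markers `1`. -/
abbrev ChainGroup (r : ℤ) : Type := (s : D.StateOfWeight r) → D.VertexGroup s.1

open Classical in
/-- The differential from degree `r` to degree `q`, the sum over all edges of the cube, from `s` to
`t` by a change of the marker at `k`, of `(-1) ^ #{j < k | s j = 1}` times the edge map. It is zero
unless `q = r + 1`. -/
def differential (r q : ℤ) : D.ChainGroup r →ₗ[ℤ] D.ChainGroup q :=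
  LinearMap.pi fun t => ∑ s : D.StateOfWeight r, ∑ k : Fin D.n,
    if s.1 k = false ∧ t.1 = Function.update s.1 k true then
      ((-1 : ℤ) ^ (Finset.univ.filter fun j => j < k ∧ s.1 j = true).card) •
        (D.edgeMap s.1 t.1 k ∘ₗ LinearMap.proj s)
    else 0

/-- The homology group `H^r(D)` of the unshifted complex: cycles modulo boundaries. -/
abbrev UnshiftedHomology (r : ℤ) : Type :=
  LinearMap.ker (D.differential r (r + 1)) ⧸
    (LinearMap.range (D.differential (r - 1) r)).submoduleOf
      (LinearMap.ker (D.differential r (r + 1)))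

/-- The Khovanov homology group `Kh^i(D)` with integer coefficients, in homological degree `i`, that
is, the sum of the groups `Kh^{i,j}(D)` over all quantum degrees `j`. The complex is shifted
by the number of negative crossings. -/
abbrev Kh (i : ℤ) : Type := D.UnshiftedHomology (i + D.numNegative)

end LinkDiagram

end

/-!
The planarity of a diagram enters through a checkerboard colouring of its faces: by Euler's formula,
the space of coboundaries of functions on the faces modulo 2 is so large that it contains the
constant function `1`. By means of the colouring, the circles of a resolution can be oriented
coherently, so that a change of one marker always merges two circles or splits one; moreover, in a
positive diagram no crossing joins a Seifert circle to itself.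

Write `V_e` for the quotient of `V^{⊗ X}`, where `X` is the set of Seifert circles, that arises by
multiplying the factors at the ends of the chord `e`, and `V_{ef}` for the quotient with respect to
two chords. The first maps of the cube of resolutions identify the vertex group at the state with
marker `1` at a crossing with chord `e` with `V_e`. The composite of the edge maps at two crossings
with chords `e` and `f` has kernel `ker (V^{⊗ X} → V_{ef})`: this is clear if `e ≠ f`, and if
`e = f` the second map is a comultiplication, hence injective. In particular cycles agree in `V_e`
at parallel crossings, and what remains is the first homology of the complex
`V^{⊗ X} → ∏ V_e → ∏ V_{ef}` over the distinct chords, the chromatic complex of `G₀(D)^{red}`.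
-/

theorem eqvGen_setoid_le_iff {H : Type*} {r : H → H → Prop} {S : Setoid H} :
    Relation.EqvGen.setoid r ≤ S ↔ ∀ a b, r a b → S a b :=
  ⟨fun hS a b h => hS (.rel a b h), fun hS => Setoid.eqvGen_le hS⟩

theorem sameCycle_setoid_le_iff {H : Type*} {σ : Equiv.Perm H} {S : Setoid H} :
    Equiv.Perm.SameCycle.setoid σ ≤ S ↔ ∀ h, S h (σ h) := by
  refine ⟨fun hS h => hS ⟨1, by rw [zpow_one]⟩, fun hS => ?_⟩
  have hpow (i : ℕ) (h : H) : S h ((σ ^ i) h) := by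
    induction i with
    | zero => exact S.refl h
    | succ i ih => exact pow_succ' σ i ▸ S.trans ih (hS _)
  rintro a _ ⟨i, rfl⟩
  obtain ⟨i, rfl | rfl⟩ := i.eq_nat_or_neg
  · exact zpow_natCast σ i ▸ hpow i a
  · have := hpow i ((σ ^ (-(i : ℤ))) a)
    rw [← zpow_natCast, ← Equiv.Perm.mul_apply, zpow_neg, mul_inv_cancel] at this
    exact zpow_neg σ i ▸ S.symm this

section Invariants

variable {H : Type*} (K : Type*) [Field K]

/-- The functions that are constant on the classes of an equivalence relation. -/
def invariants (S : Setoid H) : Submodule K (H → K) where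
  carrier := {f | S ≤ Setoid.ker f}
  add_mem' hf hg _ _ h := congrArg₂ (· + ·) (hf h) (hg h)
  zero_mem' _ _ _ := rfl
  smul_mem' a _ hf _ _ h := congrArg (a • ·) (hf h)

variable {K}

theorem mem_invariants {S : Setoid H} {f : H → K} : f ∈ invariants K S ↔ S ≤ Setoid.ker f := .rfl

theorem mem_invariants_sameCycle {σ : Equiv.Perm H} {f : H → K} :
    f ∈ invariants K (Equiv.Perm.SameCycle.setoid σ) ↔ ∀ h, f (σ h) = f h :=
  mem_invariants.trans <| sameCycle_setoid_le_iff.trans <| forall_congr' fun _ => eq_comm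

theorem finrank_invariants [Finite H] (S : Setoid H) :
    Module.finrank K (invariants K S) = Nat.card (Quotient S) := by
  have hrange : LinearMap.range (LinearMap.funLeft K K (Quotient.mk S)) = invariants K S := by
    ext f
    refine ⟨?_, fun hf => ⟨Quotient.lift f fun _ _ h => hf h, rfl⟩⟩
    rintro ⟨g, rfl⟩ a b h
    exact congrArg g (Quotient.sound h)
  have := Fintype.ofFinite (Quotient S)
  rw [← hrange, LinearMap.finrank_range_of_inj
    (LinearMap.funLeft_injective_of_surjective K K _ Quotient.mk_surjective),
    Module.finrank_fintype_fun_eq_card, Nat.card_eq_fintype_card]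

theorem mem_of_dotProduct_eq_zero [Fintype H] {B W : Submodule K (H → K)}
    (hBW : ∀ b ∈ B, ∀ w ∈ W, b ⬝ᵥ w = 0)
    (hrank : Fintype.card H ≤ Module.finrank K B + Module.finrank K W)
    {x : H → K} (hx : ∀ w ∈ W, x ⬝ᵥ w = 0) : x ∈ B := by
  classical
  let e := (dotProductEquiv K H).symm
  have hmem (y : H → K) : y ∈ W.dualAnnihilator.map e.toLinearMap ↔ ∀ w ∈ W, y ⬝ᵥ w = 0 := by
    rw [Submodule.mem_map_equiv, Submodule.mem_dualAnnihilator]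
    rfl
  have hB : B = W.dualAnnihilator.map e.toLinearMap := by
    refine Submodule.eq_of_le_of_finrank_le (fun b hb => (hmem b).2 (hBW b hb)) ?_
    have := Subspace.finrank_add_finrank_dualAnnihilator_eq W
    rw [Module.finrank_fintype_fun_eq_card] at this
    rw [LinearEquiv.finrank_map_eq]
    omega
  exact hB ▸ (hmem x).2 hx

end Invariants

namespace LinkDiagram

variable {D : LinkDiagram}

section Checkerboard

variable (D) in
/-- The coboundary `f ↦ f + f ∘ glue` modulo 2. If `f` is a function on the faces, its value at `h`
is the difference of the values of `f` at the two faces along the edge of `h`. -/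
def edgeDifference : (D.HalfEdge → ZMod 2) →ₗ[ZMod 2] (D.HalfEdge → ZMod 2) :=
  LinearMap.id + LinearMap.funLeft (ZMod 2) (ZMod 2) D.glue

theorem edgeDifference_apply (f : D.HalfEdge → ZMod 2) (h : D.HalfEdge) :
    D.edgeDifference f h = f h + f (D.glue h) := rfl

theorem ker_edgeDifference :
    LinearMap.ker D.edgeDifference = invariants (ZMod 2) (Equiv.Perm.SameCycle.setoid D.glue) := by
  ext f
  rw [LinearMap.mem_ker, mem_invariants_sameCycle, funext_iff]
  exact forall_congr' fun h => by
    rw [edgeDifference_apply, Pi.zero_apply, CharTwo.add_eq_zero, eq_comm]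

theorem mem_invariants_face {f : D.HalfEdge → ZMod 2} :
    f ∈ invariants (ZMod 2) (Equiv.Perm.SameCycle.setoid (facePermutation D.glue)) ↔
      ∀ h, f (D.glue h) = f ((rotateHalfEdge D.n).symm h) := by
  rw [mem_invariants_sameCycle]
  have happly (h) : facePermutation D.glue h = (rotateHalfEdge D.n).symm (D.glue h) := rfl
  constructor <;> intro hf h
  · rw [← hf (D.glue h), happly, D.glue_glue]
  · rw [happly, ← hf, D.glue_glue]

theorem mem_invariants_connected {f : D.HalfEdge → ZMod 2} :
    f ∈ invariants (ZMod 2) (connectedSetoid D.glue) ↔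
      (∀ h, f (D.glue h) = f h) ∧ ∀ h, f (rotateHalfEdge D.n h) = f h := by
  rw [connectedSetoid, mem_invariants, eqvGen_setoid_le_iff]
  constructor
  · exact fun hf => ⟨fun h => (hf _ _ (.inl rfl)).symm, fun h => (hf _ _ (.inr rfl)).symm⟩
  · rintro ⟨hglue, hrotate⟩ a _ (rfl | rfl)
    exacts [(hglue a).symm, (hrotate a).symm]

theorem finrank_map_edgeDifference :
    Module.finrank (ZMod 2) ((invariants (ZMod 2)
      (Equiv.Perm.SameCycle.setoid (facePermutation D.glue))).map D.edgeDifference) =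
        D.n + Nat.card (Quotient (connectedSetoid D.glue)) := by
  set F := invariants (ZMod 2) (Equiv.Perm.SameCycle.setoid (facePermutation D.glue))
  set C := invariants (ZMod 2) (connectedSetoid D.glue)
  have hker (f) : f ∈ C ↔ f ∈ LinearMap.ker D.edgeDifference ∧ f ∈ F := by
    rw [ker_edgeDifference, mem_invariants_sameCycle, mem_invariants_face, mem_invariants_connected]
    refine and_congr_right fun hglue => ⟨fun hrotate h => ?_, fun hface h => ?_⟩
    · rw [hglue, ← hrotate ((rotateHalfEdge D.n).symm h), Equiv.apply_symm_apply]
    · rw [← hglue, hface, Equiv.symm_apply_apply]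
  have hkerF : LinearMap.ker (D.edgeDifference.domRestrict F) = C.submoduleOf F := by
    ext f
    exact ⟨fun hf => (hker f).2 ⟨hf, f.2⟩, fun hf => ((hker f).1 hf).1⟩
  have hrank := LinearMap.finrank_range_add_finrank_ker (D.edgeDifference.domRestrict F)
  rw [LinearMap.range_domRestrict, hkerF,
    (Submodule.submoduleOfEquivOfLe fun f hf => ((hker f).1 hf).2).finrank_eq,
    finrank_invariants, finrank_invariants, D.planar] at hrank
  omega

theorem le_finrank_invariants_glue :
    2 * D.n ≤ Module.finrank (ZMod 2)
      (invariants (ZMod 2) (Equiv.Perm.SameCycle.setoid D.glue)) := by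
  have hrange : LinearMap.range D.edgeDifference ≤
      invariants (ZMod 2) (Equiv.Perm.SameCycle.setoid D.glue) := by
    rintro _ ⟨f, rfl⟩
    refine mem_invariants_sameCycle.2 fun h => ?_
    rw [edgeDifference_apply, edgeDifference_apply, D.glue_glue, add_comm]
  have hrank := LinearMap.finrank_range_add_finrank_ker D.edgeDifference
  rw [ker_edgeDifference, Module.finrank_fintype_fun_eq_card, Fintype.card_prod, Fintype.card_fin,
    Fintype.card_fin] at hrank
  linarith [Submodule.finrank_mono hrange]

theorem le_finrank_invariants_rotate :
    D.n ≤ Module.finrank (ZMod 2)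
      (invariants (ZMod 2) (Equiv.Perm.SameCycle.setoid (rotateHalfEdge D.n))) := by
  have hinj := LinearMap.funLeft_injective_of_surjective (ZMod 2) (ZMod 2)
    (Prod.fst : D.HalfEdge → Fin D.n) Prod.fst_surjective
  have hrank := LinearMap.finrank_range_of_inj hinj
  rw [Module.finrank_fintype_fun_eq_card, Fintype.card_fin] at hrank
  have hrange : LinearMap.range (LinearMap.funLeft (ZMod 2) (ZMod 2) Prod.fst) ≤
      invariants (ZMod 2) (Equiv.Perm.SameCycle.setoid (rotateHalfEdge D.n)) := by
    rintro _ ⟨f, rfl⟩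
    exact mem_invariants_sameCycle.2 fun _ => rfl
  exact hrank.symm.trans_le (Submodule.finrank_mono hrange)

theorem glue_ne (h : D.HalfEdge) : D.glue h ≠ h := fun heq => by
  simpa [heq] using D.oriented h

theorem edgeDifference_dotProduct_eq_zero {f g₁ g₂ : D.HalfEdge → ZMod 2}
    (hf : f ∈ invariants (ZMod 2) (Equiv.Perm.SameCycle.setoid (facePermutation D.glue)))
    (hg₁ : g₁ ∈ invariants (ZMod 2) (Equiv.Perm.SameCycle.setoid D.glue))
    (hg₂ : g₂ ∈ invariants (ZMod 2) (Equiv.Perm.SameCycle.setoid (rotateHalfEdge D.n))) :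
    D.edgeDifference f ⬝ᵥ (g₁ + g₂) = 0 := by
  rw [mem_invariants_face] at hf
  rw [mem_invariants_sameCycle] at hg₁ hg₂
  have hglue : ∑ h, f (D.glue h) * g₁ h = ∑ h, f h * g₁ h := by
    rw [← Equiv.sum_comp D.glue fun h => f h * g₁ h]
    exact Finset.sum_congr rfl fun h _ => by rw [hg₁]
  have hrotate : ∑ h, f (D.glue h) * g₂ h = ∑ h, f h * g₂ h := by
    rw [← Equiv.sum_comp (rotateHalfEdge D.n).symm fun h => f h * g₂ h]
    exact Finset.sum_congr rfl fun h _ => by rw [hf, ← hg₂ ((rotateHalfEdge D.n).symm h),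
      Equiv.apply_symm_apply]
  simp only [dotProduct, edgeDifference_apply, Pi.add_apply, add_mul, mul_add,
    Finset.sum_add_distrib, hglue, hrotate, CharTwo.add_self_eq_zero]

theorem one_dotProduct_eq_zero {g₁ g₂ : D.HalfEdge → ZMod 2}
    (hg₁ : g₁ ∈ invariants (ZMod 2) (Equiv.Perm.SameCycle.setoid D.glue))
    (hg₂ : g₂ ∈ invariants (ZMod 2) (Equiv.Perm.SameCycle.setoid (rotateHalfEdge D.n))) :
    (1 : D.HalfEdge → ZMod 2) ⬝ᵥ (g₁ + g₂) = 0 := by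
  rw [mem_invariants_sameCycle] at hg₁ hg₂
  have hedge : ∑ h, g₁ h = 0 := Finset.sum_involution (fun h _ => D.glue h)
    (fun h _ => by rw [hg₁, CharTwo.add_self_eq_zero]) (fun h _ _ => D.glue_ne h)
    (fun _ _ => Finset.mem_univ _) fun h _ => D.glue_glue h
  have hopposite (h : D.HalfEdge) :
      rotateHalfEdge D.n (rotateHalfEdge D.n h) = (h.1, h.2 + 2) :=
    Prod.ext rfl (add_assoc h.2 1 1)
  have hcrossing : ∑ h, g₂ h = 0 := Finset.sum_involution (fun h _ => (h.1, h.2 + 2))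
    (fun h _ => by rw [← hopposite, hg₂, hg₂, CharTwo.add_self_eq_zero])
    (fun h _ _ => by simp [Prod.ext_iff])
    (fun _ _ => Finset.mem_univ _) fun h _ => by simp [add_assoc]
  rw [one_dotProduct, ← hedge]
  simp only [Pi.add_apply, Finset.sum_add_distrib, hcrossing, add_zero]

theorem exists_checkerboard (D : LinkDiagram) : ∃ f : D.HalfEdge → ZMod 2,
    (∀ h, f (D.glue h) = f h + 1) ∧ ∀ h, f (rotateHalfEdge D.n h) = f h + 1 := by
  set F := invariants (ZMod 2) (Equiv.Perm.SameCycle.setoid (facePermutation D.glue))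
  set E := invariants (ZMod 2) (Equiv.Perm.SameCycle.setoid D.glue)
  set V := invariants (ZMod 2) (Equiv.Perm.SameCycle.setoid (rotateHalfEdge D.n))
  have hinf : E ⊓ V = invariants (ZMod 2) (connectedSetoid D.glue) := by
    ext f
    rw [Submodule.mem_inf, mem_invariants_sameCycle, mem_invariants_sameCycle,
      mem_invariants_connected]
  have hrank : Fintype.card D.HalfEdge ≤
      Module.finrank (ZMod 2) (F.map D.edgeDifference) + Module.finrank (ZMod 2) ↥(E ⊔ V) := by
    have hsup := Submodule.finrank_sup_add_finrank_inf_eq E V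
    rw [hinf, finrank_invariants] at hsup
    have hE : 2 * D.n ≤ Module.finrank (ZMod 2) E := le_finrank_invariants_glue
    have hV : D.n ≤ Module.finrank (ZMod 2) V := le_finrank_invariants_rotate
    rw [finrank_map_edgeDifference, Fintype.card_prod, Fintype.card_fin, Fintype.card_fin]
    omega
  obtain ⟨f, hf, hone⟩ : (1 : D.HalfEdge → ZMod 2) ∈ F.map D.edgeDifference := by
    refine mem_of_dotProduct_eq_zero (W := E ⊔ V) ?_ hrank ?_
    · rintro _ ⟨f, hf, rfl⟩ w hw
      obtain ⟨g₁, hg₁, g₂, hg₂, rfl⟩ := Submodule.mem_sup.1 hw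
      exact edgeDifference_dotProduct_eq_zero hf hg₁ hg₂
    · rintro w hw
      obtain ⟨g₁, hg₁, g₂, hg₂, rfl⟩ := Submodule.mem_sup.1 hw
      exact one_dotProduct_eq_zero hg₁ hg₂
  have hglue (h) : f (D.glue h) = f h + 1 := by
    rw [← Pi.one_apply (M := fun _ => ZMod 2) h, ← hone, edgeDifference_apply,
      CharTwo.add_cancel_left]
  refine ⟨f, hglue, fun h => ?_⟩
  have hrotate := hglue (rotateHalfEdge D.n h)
  rw [mem_invariants_face.1 hf, Equiv.symm_apply_apply] at hrotate
  rw [hrotate, CharTwo.add_cancel_right]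

end Checkerboard

end LinkDiagram

section FirstReturn

variable {H : Type*} [Finite H] {σ : Equiv.Perm H} {a b : H} {j : ℕ}

theorem sameCycle_iff_iterate_eq (hab : a ≠ b) (hpos : 0 < j) (hj : σ^[j] a = a ∨ σ^[j] a = b)
    (hlt : ∀ i < j, 0 < i → σ^[i] a ≠ b) : σ.SameCycle a b ↔ σ^[j] a = b := by
  refine ⟨fun h => hj.resolve_left fun hperiod => ?_,
    fun h => ⟨j, zpow_natCast σ j ▸ Equiv.Perm.iterate_eq_pow σ j ▸ h⟩⟩
  obtain ⟨m, hm⟩ := h.exists_nat_pow_eq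
  rw [← Equiv.Perm.iterate_eq_pow,
    ← Function.IsPeriodicPt.iterate_mod_apply (f := σ) hperiod] at hm
  rcases (m % j).eq_zero_or_pos with h0 | h0
  · exact hab (by simpa [h0] using hm)
  · exact hlt _ (Nat.mod_lt _ hpos) h0 hm

theorem exists_first_return (σ : Equiv.Perm H) (a b : H) :
    ∃ j, 0 < j ∧ (σ^[j] a = a ∨ σ^[j] a = b) ∧ ∀ i < j, 0 < i → σ^[i] a ≠ a ∧ σ^[i] a ≠ b := by
  classical
  have hex : ∃ j, 0 < j ∧ (σ^[j] a = a ∨ σ^[j] a = b) :=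
    ⟨orderOf σ, orderOf_pos σ, .inl (by rw [Equiv.Perm.iterate_eq_pow, pow_orderOf_eq_one]; rfl)⟩
  refine ⟨Nat.find hex, (Nat.find_spec hex).1, (Nat.find_spec hex).2, fun i hi h0 => ?_⟩
  exact not_or.1 fun h => Nat.find_min hex hi ⟨h0, h⟩

theorem sameCycle_swap_comp_iff [DecidableEq H] {τ : Equiv.Perm H} (hab : a ≠ b)
    (hτ : ∀ x, σ.SameCycle a x → τ x = Equiv.swap a b (σ x)) :
    τ.SameCycle a b ↔ ¬ σ.SameCycle a b := by
  obtain ⟨j, hpos, hj, hlt⟩ := exists_first_return σ a b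
  have hstep (i : ℕ) : τ (σ^[i] a) = Equiv.swap a b (σ^[i + 1] a) := by
    rw [hτ _ ⟨i, by rw [zpow_natCast, Equiv.Perm.iterate_eq_pow]⟩, Function.iterate_succ_apply']
  have hagree (i : ℕ) (hi : i < j) : τ^[i] a = σ^[i] a := by
    induction i with
    | zero => rfl
    | succ i ih =>
      rw [Function.iterate_succ_apply', ih (by omega), hstep]
      exact Equiv.swap_apply_of_ne_of_ne (hlt _ hi i.succ_pos).1 (hlt _ hi i.succ_pos).2
  have hreturn : τ^[j] a = Equiv.swap a b (σ^[j] a) := by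
    obtain ⟨i, rfl⟩ := Nat.exists_eq_succ_of_ne_zero hpos.ne'
    rw [Function.iterate_succ_apply', hagree i i.lt_succ_self, hstep]
  rw [sameCycle_iff_iterate_eq hab hpos hj fun i hi h0 => (hlt i hi h0).2,
    sameCycle_iff_iterate_eq (j := j) hab hpos, hreturn]
  · rcases hj with h | h <;> simp [h, hab]
  · rcases hj with h | h <;> simp [hreturn, h]
  · exact fun i hi h0 => hagree i hi ▸ (hlt i hi h0).2

end FirstReturn

namespace LinkDiagram

variable {D : LinkDiagram}

section Circles

variable {s t : D.State} {k : Fin D.n}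

theorem circleSetoid_le_iff {S : Setoid D.HalfEdge} :
    D.circleSetoid s ≤ S ↔ ∀ h, S h (D.glue h) ∧ S h (D.smooth s h) := by
  rw [circleSetoid, eqvGen_setoid_le_iff]
  refine ⟨fun hS h => ⟨hS _ _ (.inl rfl), hS _ _ (.inr rfl)⟩, ?_⟩
  rintro hS a _ (rfl | rfl)
  exacts [(hS a).1, (hS a).2]

theorem circleOf_eq_iff {a b : D.HalfEdge} :
    D.circleOf s a = D.circleOf s b ↔ D.circleSetoid s a b :=
  Sum.inl_injective.eq_iff.trans Quotient.eq

theorem circleOf_glue (s : D.State) (h : D.HalfEdge) :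
    D.circleOf s (D.glue h) = D.circleOf s h :=
  (circleOf_eq_iff.2 (circleSetoid_le_iff.1 le_rfl h).1).symm

theorem circleOf_smooth (s : D.State) (h : D.HalfEdge) :
    D.circleOf s (D.smooth s h) = D.circleOf s h :=
  (circleOf_eq_iff.2 (circleSetoid_le_iff.1 le_rfl h).2).symm

theorem smooth_smooth (s : D.State) : Function.Involutive (D.smooth s) := by
  rintro ⟨c, i⟩
  cases hc : s c <;> fin_cases i <;> simp [smooth, hc]

theorem smooth_congr {h : D.HalfEdge} (hst : s h.1 = t h.1) : D.smooth s h = D.smooth t h := by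
  rw [smooth, smooth, hst]

theorem smooth_smooth_of_ne (hk : s k ≠ t k) (i : Fin 4) :
    D.smooth t (D.smooth s (k, i)) = (k, i + 2) := by
  have htk : t k = !s k := Bool.eq_not_of_ne hk.symm
  cases hs : s k <;> fin_cases i <;> simp [smooth, htk, hs]

variable (D) in
/-- The chord of the state graph that joins the two arcs of the smoothing of `s` at `k`, given by
its ends. -/
def chord (s : D.State) (k : Fin D.n) : Sym2 (D.Circle s) :=
  s(D.circleOf s (k, 0), D.circleOf s (k, 2))

variable (D) in
/-- A diagram is `0`-adequate if no crossing joins a circle of its all-`0` resolution to itself. -/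
def IsZeroAdequate : Prop := ∀ k, ¬ (D.chord D.zeroState k).IsDiag

theorem isDiag_chord_iff :
    (D.chord s k).IsDiag ↔ D.circleOf s (k, 0) = D.circleOf s (k, 2) := Sym2.mk_isDiag_iff

theorem circleOf_mem_chord (s : D.State) (k : Fin D.n) (i : Fin 4) :
    D.circleOf s (k, i) ∈ D.chord s k := by
  have h1 : D.circleOf s (k, 1) = D.circleOf s (k, if s k then 2 else 0) := by
    rw [← circleOf_smooth s (k, 1)]
    cases hs : s k <;> simp [smooth, hs]
  have h3 : D.circleOf s (k, 3) = D.circleOf s (k, if s k then 0 else 2) := by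
    rw [← circleOf_smooth s (k, 3)]
    cases hs : s k <;> simp [smooth, hs]
  rw [chord, Sym2.mem_iff]
  match i with
  | 0 => exact .inl rfl
  | 1 => rw [h1]; cases s k <;> simp
  | 2 => exact .inr rfl
  | 3 => rw [h3]; cases s k <;> simp

end Circles

section Flip

variable {f : D.HalfEdge → ZMod 2} {s t : D.State} {k : Fin D.n}

variable (D) in
/-- Going along the circles of a resolution: follow the edge to its other end, then cross the
arc of the smoothing. Each circle consists of two cycles, one for each direction. -/
def circlePerm (s : D.State) : Equiv.Perm D.HalfEdge := (smooth_smooth s).toPerm * D.glue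

theorem circlePerm_apply (s : D.State) (h : D.HalfEdge) :
    D.circlePerm s h = D.smooth s (D.glue h) := rfl

theorem sameCycle_circlePerm_glue {a b : D.HalfEdge} :
    (D.circlePerm s).SameCycle (D.glue a) (D.glue b) ↔ (D.circlePerm s).SameCycle a b := by
  have hinv : (D.circlePerm s)⁻¹ = D.glue * D.circlePerm s * D.glue⁻¹ := by
    refine inv_eq_of_mul_eq_one_left (Equiv.ext fun h => ?_)
    change D.glue (D.smooth s (D.glue (D.glue.symm (D.smooth s (D.glue h))))) = h
    rw [D.glue.apply_symm_apply, smooth_smooth, D.glue_glue]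
  rw [← Equiv.Perm.sameCycle_inv, hinv, Equiv.Perm.sameCycle_conj, Equiv.Perm.inv_def,
    D.glue.symm_apply_apply, D.glue.symm_apply_apply]

theorem sameCycle_setoid_le_circleSetoid (s : D.State) :
    Equiv.Perm.SameCycle.setoid (D.circlePerm s) ≤ D.circleSetoid s :=
  sameCycle_setoid_le_iff.2 fun h => by
    rw [← circleOf_eq_iff, circlePerm_apply, circleOf_smooth, circleOf_glue]

theorem sameCycle_or_sameCycle_glue {a b : D.HalfEdge} (hab : D.circleSetoid s a b) :
    (D.circlePerm s).SameCycle a b ∨ (D.circlePerm s).SameCycle a (D.glue b) := by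
  have hglue {a b} (h : (D.circlePerm s).SameCycle a (D.glue b)) :
      (D.circlePerm s).SameCycle (D.glue a) b := by
    rwa [← sameCycle_circlePerm_glue, D.glue_glue]
  let S : Setoid D.HalfEdge :=
    { r a b := (D.circlePerm s).SameCycle a b ∨ (D.circlePerm s).SameCycle a (D.glue b)
      iseqv :=
        { refl a := .inl (.refl _ a)
          symm := Or.imp .symm fun h => (hglue h).symm
          trans := by
            rintro a b c (hab | hab) (hbc | hbc)
            · exact .inl (hab.trans hbc)
            · exact .inr (hab.trans hbc)
            · exact .inr (hab.trans (sameCycle_circlePerm_glue.2 hbc))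
            · exact .inl (hab.trans (hglue hbc)) } }
  have hS : D.circleSetoid s ≤ S := circleSetoid_le_iff.2 fun h =>
    ⟨.inr (by rw [D.glue_glue]),
      .inr (sameCycle_circlePerm_glue.1 (by
        rw [D.glue_glue]
        nth_rw 2 [← D.glue_glue h]
        rw [← circlePerm_apply]
        exact Equiv.Perm.sameCycle_apply_right.2 (.refl _ _)))⟩
  exact hS hab

theorem apply_eq_of_rotate (hrotate : ∀ h, f (rotateHalfEdge D.n h) = f h + 1) (i : Fin 4) :
    f (k, i) = f (k, 0) + (i : ℕ) := by
  have h1 : f (k, 1) = f (k, 0) + 1 := hrotate (k, 0)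
  have h2 : f (k, 2) = f (k, 1) + 1 := hrotate (k, 1)
  have h3 : f (k, 3) = f (k, 2) + 1 := hrotate (k, 2)
  match i with
  | 0 => exact (add_zero _).symm
  | 1 => rw [h1]; rfl
  | 2 => rw [h2, h1, add_assoc]; rfl
  | 3 => rw [h3, h2, h1, add_assoc, add_assoc]; rfl

theorem apply_smooth_of_rotate (hrotate : ∀ h, f (rotateHalfEdge D.n h) = f h + 1)
    (s : D.State) (h : D.HalfEdge) : f (D.smooth s h) = f h + 1 := by
  obtain ⟨c, i⟩ := h
  have h0 : ∀ i : Fin 4, ((![1, 0, 3, 2] i : Fin 4) : ℕ) = ((i : ℕ) + 1 : ZMod 2) := by decide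
  have h1 : ∀ i : Fin 4, ((![3, 2, 1, 0] i : Fin 4) : ℕ) = ((i : ℕ) + 1 : ZMod 2) := by decide
  rw [smooth, apply_eq_of_rotate hrotate, apply_eq_of_rotate hrotate i, add_assoc]
  cases s c
  exacts [congrArg _ (h0 i), congrArg _ (h1 i)]

theorem apply_eq_of_sameCycle (hglue : ∀ h, f (D.glue h) = f h + 1)
    (hrotate : ∀ h, f (rotateHalfEdge D.n h) = f h + 1) {a b : D.HalfEdge}
    (hab : (D.circlePerm s).SameCycle a b) : f a = f b := by
  have hle : Equiv.Perm.SameCycle.setoid (D.circlePerm s) ≤ Setoid.ker f :=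
    sameCycle_setoid_le_iff.2 fun h => by
      rw [Setoid.ker_def, circlePerm_apply, apply_smooth_of_rotate hrotate, hglue,
        CharTwo.add_cancel_right]
  exact hle hab

theorem circleOf_eq_iff_sameCycle (hglue : ∀ h, f (D.glue h) = f h + 1)
    (hrotate : ∀ h, f (rotateHalfEdge D.n h) = f h + 1) {a b : D.HalfEdge} (hab : f a = f b) :
    D.circleOf s a = D.circleOf s b ↔ (D.circlePerm s).SameCycle a b := by
  rw [circleOf_eq_iff]
  refine ⟨fun h => (sameCycle_or_sameCycle_glue h).resolve_right fun h' => ?_,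
    fun h => sameCycle_setoid_le_circleSetoid s h⟩
  have := apply_eq_of_sameCycle hglue hrotate h'
  rw [hglue, hab, left_eq_add] at this
  exact one_ne_zero this

theorem circlePerm_eq_swap (hglue : ∀ h, f (D.glue h) = f h + 1)
    (hrotate : ∀ h, f (rotateHalfEdge D.n h) = f h + 1) (hst : Set.EqOn s t {k}ᶜ)
    (hk : s k ≠ t k) {x : D.HalfEdge} (hx : (D.circlePerm s).SameCycle (k, 0) x) :
    D.circlePerm t x = Equiv.swap (k, 0) (k, 2) (D.circlePerm s x) := by
  have hcolour : f (k, 0) = f (D.circlePerm s x) :=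
    apply_eq_of_sameCycle hglue hrotate (Equiv.Perm.sameCycle_apply_right.2 hx)
  have happly : D.circlePerm t x = D.smooth t (D.smooth s (D.circlePerm s x)) := by
    rw [circlePerm_apply, circlePerm_apply, smooth_smooth]
  rw [happly]
  generalize D.circlePerm s x = w at hcolour
  obtain ⟨c, i⟩ := w
  rcases eq_or_ne c k with rfl | hc
  · rw [smooth_smooth_of_ne hk]
    rw [apply_eq_of_rotate hrotate i, left_eq_add] at hcolour
    have heven : ∀ i : Fin 4, ((i : ℕ) : ZMod 2) = 0 → i = 0 ∨ i = 2 := by decide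
    rcases heven i hcolour with rfl | rfl
    exacts [(Equiv.swap_apply_left _ _).symm, (Equiv.swap_apply_right _ _).symm]
  · rw [smooth_congr (s := t) (t := s) (hst hc).symm, smooth_smooth,
      Equiv.swap_apply_of_ne_of_ne] <;> simp [hc]

theorem isDiag_chord_iff_not_isDiag (hst : Set.EqOn s t {k}ᶜ) (hk : s k ≠ t k) :
    (D.chord t k).IsDiag ↔ ¬ (D.chord s k).IsDiag := by
  obtain ⟨f, hglue, hrotate⟩ := D.exists_checkerboard
  have h2 : f (k, 0) = f (k, 2) := by
    rw [apply_eq_of_rotate hrotate 2]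
    exact (add_zero _).symm
  rw [isDiag_chord_iff, isDiag_chord_iff, circleOf_eq_iff_sameCycle hglue hrotate h2,
    circleOf_eq_iff_sameCycle hglue hrotate h2]
  exact sameCycle_swap_comp_iff (by simp) fun x hx => circlePerm_eq_swap hglue hrotate hst hk hx

theorem IsPositive.isZeroAdequate (hD : D.IsPositive) : D.IsZeroAdequate := by
  classical
  obtain ⟨f, hglue, hrotate⟩ := D.exists_checkerboard
  -- the colour of the face to the left of the edge through `h`
  let left (h : D.HalfEdge) : ZMod 2 := if isOutgoing (D.positive h.1) h.2 then f h else f h + 1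
  have hle : D.circleSetoid D.zeroState ≤ Setoid.ker left := circleSetoid_le_iff.2 fun h => by
    constructor
    · rw [Setoid.ker_def]
      by_cases hout : isOutgoing (D.positive h.1) h.2 <;>
        simp [left, D.oriented, hout, hglue, add_assoc, CharTwo.add_self_eq_zero]
    · have hout : isOutgoing (D.positive (D.smooth D.zeroState h).1) (D.smooth D.zeroState h).2 ↔
          ¬ isOutgoing (D.positive h.1) h.2 := by
        obtain ⟨c, i⟩ := h
        simp only [smooth, zeroState, hD c]
        fin_cases i <;> simp [isOutgoing]
      rw [Setoid.ker_def]
      by_cases hh : isOutgoing (D.positive h.1) h.2 <;>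
        simp [left, hout, hh, apply_smooth_of_rotate hrotate, add_assoc, CharTwo.add_self_eq_zero]
  intro k hdiag
  have : left (k, 0) = left (k, 2) := hle (circleOf_eq_iff.1 (isDiag_chord_iff.1 hdiag))
  simp [left, isOutgoing, hD k, apply_eq_of_rotate hrotate 2, CharTwo.two_eq_zero] at this

end Flip

end LinkDiagram

section LabelMatrix

variable {X Y Z : Type*}

/-- The equivalence relation that identifies the two ends of an edge. -/
def endsSetoid (e : Sym2 X) : Setoid X where
  r a b := a = b ∨ a ∈ e ∧ b ∈ e
  iseqv :=
    { refl _ := .inl rfl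
      symm := Or.imp .symm .symm
      trans := by
        rintro _ _ _ (rfl | ⟨ha, hb⟩) (rfl | ⟨hb', hc⟩)
        exacts [.inl rfl, .inr ⟨hb', hc⟩, .inr ⟨ha, hb⟩, .inr ⟨ha, hc⟩] }

theorem eq_of_mem_of_isDiag {e : Sym2 X} (he : e.IsDiag) {a b : X} (ha : a ∈ e) (hb : b ∈ e) :
    a = b := by
  induction e with | _ x y
  obtain rfl := Sym2.mk_isDiag_iff.1 he
  rw [Sym2.mem_iff, or_self] at ha hb
  exact ha.trans hb.symm

theorem isDiag_map_iff {p : X → Y} {e e' : Sym2 X} (hp : Setoid.ker p = endsSetoid e)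
    (he' : ¬ e'.IsDiag) : (e'.map p).IsDiag ↔ e' = e := by
  induction e' with | _ a b
  have hab : a ≠ b := mt Sym2.mk_isDiag_iff.2 he'
  rw [Sym2.map_mk, Sym2.mk_isDiag_iff, ← Setoid.ker_def, hp, eq_comm,
    ← Sym2.mem_and_mem_iff hab]
  exact ⟨fun h => h.resolve_left hab, .inr⟩

theorem endsSetoid_iff_mem {e : Sym2 X} {a b : X} (hb : b ∈ e) : endsSetoid e a b ↔ a ∈ e := by
  refine ⟨?_, fun ha => .inr ⟨ha, hb⟩⟩
  rintro (rfl | h)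
  exacts [hb, h.1]

theorem endsSetoid_le_iff {e : Sym2 X} {S : Setoid X} :
    endsSetoid e ≤ S ↔ ∀ a ∈ e, ∀ b ∈ e, S a b := by
  refine ⟨fun h a ha b hb => h (.inr ⟨ha, hb⟩), fun h a b => ?_⟩
  rintro (rfl | ⟨ha, hb⟩)
  exacts [S.refl _, h _ ha _ hb]

theorem comap_endsSetoid_map (p : X → Y) (e : Sym2 X) :
    (endsSetoid (e.map p)).comap p = Setoid.ker p ⊔ endsSetoid e := by
  refine le_antisymm ?_ (sup_le (fun _ _ h => .inl h) (endsSetoid_le_iff.2 fun a ha b hb =>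
    .inr ⟨Sym2.mem_map.2 ⟨a, ha, rfl⟩, Sym2.mem_map.2 ⟨b, hb, rfl⟩⟩))
  have hker : Setoid.ker p ≤ Setoid.ker p ⊔ endsSetoid e := le_sup_left
  have hends : endsSetoid e ≤ Setoid.ker p ⊔ endsSetoid e := le_sup_right
  rintro a b (h | ⟨ha, hb⟩)
  · exact hker h
  · obtain ⟨a', ha', haa'⟩ := Sym2.mem_map.1 ha
    obtain ⟨b', hb', hbb'⟩ := Sym2.mem_map.1 hb
    exact Setoid.trans' _ (hker haa'.symm)
      (Setoid.trans' _ (hends (.inr ⟨ha', hb'⟩)) (hker hbb'))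

theorem comap_endsSetoid_map_equiv (θ : X ≃ Y) (e : Sym2 X) :
    (endsSetoid (e.map θ)).comap θ = endsSetoid e := by
  have hker : Setoid.ker θ = ⊥ := Setoid.ext fun _ _ => θ.apply_eq_iff_eq
  rw [comap_endsSetoid_map, hker, bot_sup_eq]

theorem comap_sup_equiv (θ : X ≃ Y) (R S : Setoid Y) :
    (R ⊔ S).comap θ = R.comap θ ⊔ S.comap θ := by
  have hle {T : Setoid Y} (hT : T.comap θ ≤ R.comap θ ⊔ S.comap θ) :
      T ≤ (R.comap θ ⊔ S.comap θ).comap θ.symm := fun a b h =>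
    hT (show T (θ (θ.symm a)) (θ (θ.symm b)) by rwa [θ.apply_symm_apply, θ.apply_symm_apply])
  refine le_antisymm (fun a b h => ?_)
    (sup_le (fun _ _ h => (le_sup_left : R ≤ R ⊔ S) h) fun _ _ h => (le_sup_right : S ≤ R ⊔ S) h)
  have := sup_le (hle le_sup_left) (hle le_sup_right) h
  rwa [Setoid.comap_rel, θ.symm_apply_apply, θ.symm_apply_apply] at this

open Classical in
/-- The labelling of `Y` that gives the label `β` to the images of the elements of `X` with label
`β`, and the other label to all other elements of `Y`. -/
noncomputable def mapLabel (β : Bool) (p : X → Y) (x : X → Bool) : Y → Bool :=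
  fun b => if ∃ a, p a = b ∧ x a = β then β else !β

theorem mapLabel_eq_iff {β : Bool} {p : X → Y} {x : X → Bool} {b : Y} :
    mapLabel β p x b = β ↔ ∃ a, p a = b ∧ x a = β := by
  simp [mapLabel]

theorem labelling_ext {x y : X → Bool} (β : Bool) (h : ∀ a, x a = β ↔ y a = β) : x = y :=
  funext fun a => by have := h a; revert this; cases x a <;> cases y a <;> cases β <;> simp

theorem image_label {β : Bool} (p : X → Y) (x : X → Bool) :
    p '' {a | x a = β} = {b | mapLabel β p x b = β} :=
  Set.ext fun b => by simp only [Set.mem_image, Set.mem_ofPred_eq, mapLabel_eq_iff, and_comm]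

theorem mapLabel_comp (β : Bool) (q : Y → Z) (p : X → Y) (x : X → Bool) :
    mapLabel β (q ∘ p) x = mapLabel β q (mapLabel β p x) :=
  labelling_ext β fun b => by simp [mapLabel_eq_iff]

theorem mapLabel_equiv (β : Bool) (θ : X ≃ Y) (x : X → Bool) : mapLabel β θ x = x ∘ θ.symm :=
  labelling_ext β fun b => by simp [mapLabel_eq_iff, ← Equiv.eq_symm_apply]

open Classical in
/-- The matrix, in the bases of labellings by `v₊` (`true`) and `v₋` (`false`), of the map
`V^{⊗ X} → V^{⊗ Y}` that multiplies the factors along the fibres of `p` (for `β = false`). For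
`β = true` it is the transpose of the matrix of the comultiplication `V^{⊗ Y} → V^{⊗ X}` along the
fibres of `p`. -/
noncomputable def labelMatrix (β : Bool) (p : X → Y) : Matrix (Y → Bool) (X → Bool) ℤ :=
  Matrix.of fun y x => if Set.InjOn p {a | x a = β} ∧ mapLabel β p x = y then 1 else 0

theorem labelMatrix_apply {β : Bool} {p : X → Y} {x : X → Bool} {y : Y → Bool}
    [Decidable (Set.InjOn p {a | x a = β} ∧ mapLabel β p x = y)] :
    labelMatrix β p y x = if Set.InjOn p {a | x a = β} ∧ mapLabel β p x = y then 1 else 0 := by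
  rw [labelMatrix, Matrix.of_apply]
  congr

theorem labelMatrix_mul [Fintype Y] [DecidableEq Y] (β : Bool) (q : Y → Z) (p : X → Y) :
    labelMatrix β q * labelMatrix β p = labelMatrix β (q ∘ p) := by
  classical
  ext z x
  have hinj : Set.InjOn (q ∘ p) {a | x a = β} ↔
      Set.InjOn p {a | x a = β} ∧ Set.InjOn q {b | mapLabel β p x b = β} := by
    rw [← image_label]
    exact ⟨fun h => ⟨h.of_comp, h.image_of_comp⟩, fun h => h.2.comp h.1 (Set.mapsTo_image _ _)⟩
  simp only [Matrix.mul_apply, labelMatrix_apply, hinj, mapLabel_comp, ite_and, mul_ite, mul_one,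
    mul_zero, Finset.sum_ite_irrel, Finset.sum_const_zero, Finset.sum_ite_eq, Finset.mem_univ,
    if_true]

theorem labelMatrix_equiv_apply (β : Bool) (θ : X ≃ Y) (x : X → Bool) (y : Y → Bool)
    [Decidable (x ∘ θ.symm = y)] : labelMatrix β θ y x = if x ∘ θ.symm = y then 1 else 0 := by
  classical
  simp only [labelMatrix_apply, θ.injective.injOn, mapLabel_equiv, true_and]

theorem labelMatrix_id (β : Bool) [DecidableEq (X → Bool)] : labelMatrix β (id : X → X) = 1 := by
  ext y x
  rw [← Equiv.coe_refl, labelMatrix_equiv_apply, Matrix.one_apply]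
  exact if_congr eq_comm rfl rfl

theorem labelMatrix_equiv_transpose (β γ : Bool) (θ : X ≃ Y) :
    (labelMatrix β θ).transpose = labelMatrix γ θ.symm := by
  classical
  ext x y
  rw [Matrix.transpose_apply, labelMatrix_equiv_apply, labelMatrix_equiv_apply, Equiv.symm_symm]
  exact if_congr (by rw [θ.comp_symm_eq, eq_comm]) rfl rfl

open Classical in
theorem labelMatrix_merge {β : Bool} {p : X → Y} {u v : X} (hp : p.Surjective)
    (hker : Setoid.ker p = endsSetoid s(u, v)) (huv : u ≠ v) (x : X → Bool) (y : Y → Bool) :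
    labelMatrix β p y x = if ∀ a, a ≠ u → a ≠ v → x a = y (p a) then
      if ¬ (x u = β ∧ x v = β) ∧ (y (p u) = β ↔ x u = β ∨ x v = β) then 1 else 0 else 0 := by
  have hpe (a b) : p a = p b ↔ a = b ∨ (a = u ∨ a = v) ∧ (b = u ∨ b = v) := by
    rw [← Setoid.ker_def, hker, ← Sym2.mem_iff, ← Sym2.mem_iff]
    rfl
  have hinj : Set.InjOn p {a | x a = β} ↔ ¬ (x u = β ∧ x v = β) := by
    refine ⟨fun h hx => huv (h hx.1 hx.2 ((hpe u v).2 (.inr ⟨.inl rfl, .inr rfl⟩))), ?_⟩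
    rintro h a ha b hb hab
    simp only [Set.mem_ofPred_eq] at ha hb
    grind
  have hpair : mapLabel β p x (p u) = β ↔ x u = β ∨ x v = β := by
    simp [mapLabel_eq_iff, hpe, or_and_right, exists_or]
  have haway (a) (hau : a ≠ u) (hav : a ≠ v) : mapLabel β p x (p a) = x a := by
    have : mapLabel β p x (p a) = β ↔ x a = β := by simp [mapLabel_eq_iff, hpe, hau, hav]
    cases hx : x a <;> cases β <;> simp_all
  have hmap : mapLabel β p x = y ↔
      (∀ a, a ≠ u → a ≠ v → x a = y (p a)) ∧ (y (p u) = β ↔ x u = β ∨ x v = β) := by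
    refine ⟨?_, fun ⟨hy, hyu⟩ => funext (hp.forall.2 fun a => ?_)⟩
    · rintro rfl
      exact ⟨fun a hau hav => (haway a hau hav).symm, hpair⟩
    · by_cases ha : a = u ∨ a = v
      · rw [(hpe a u).2 (.inr ⟨ha, .inl rfl⟩)]
        have := hpair.trans hyu.symm
        revert this
        cases mapLabel β p x (p u) <;> cases y (p u) <;> cases β <;> simp
      · rw [haway a (ha <| .inl ·) (ha <| .inr ·), hy a (ha <| .inl ·) (ha <| .inr ·)]
  rw [labelMatrix_apply]
  simp only [hinj, hmap, ← ite_and]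
  exact if_congr and_left_comm rfl rfl

end LabelMatrix

section PushPull

variable {X Y Z : Type*} [Fintype X] [DecidableEq X]

/-- The map `V^{⊗ X} → V^{⊗ Y}` that multiplies the tensor factors along the fibres of `p`. -/
noncomputable def pushMap (p : X → Z) : ((X → Bool) → ℤ) →ₗ[ℤ] ((Z → Bool) → ℤ) :=
  (labelMatrix false p).mulVecLin

/-- The map `V^{⊗ Y} → V^{⊗ X}` that comultiplies every tensor factor along the fibre of `p`. -/
noncomputable def pullMap (p : Z → X) : ((X → Bool) → ℤ) →ₗ[ℤ] ((Z → Bool) → ℤ) :=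
  (labelMatrix true p).transpose.mulVecLin

theorem pushMap_comp [Fintype Y] [DecidableEq Y] (q : Y → Z) (p : X → Y) :
    pushMap (q ∘ p) = pushMap q ∘ₗ pushMap p := by
  rw [pushMap, ← labelMatrix_mul, Matrix.mulVecLin_mul, pushMap, pushMap]

theorem pullMap_comp [Fintype Y] [DecidableEq Y] (q : Y → X) (p : Z → Y) :
    pullMap (q ∘ p) = pullMap p ∘ₗ pullMap q := by
  rw [pullMap, ← labelMatrix_mul, Matrix.transpose_mul, Matrix.mulVecLin_mul, pullMap, pullMap]

theorem pushMap_id : pushMap (id : X → X) = LinearMap.id := by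
  rw [pushMap, labelMatrix_id, Matrix.mulVecLin_one]

theorem pullMap_id : pullMap (id : X → X) = LinearMap.id := by
  rw [pullMap, labelMatrix_id, Matrix.transpose_one, Matrix.mulVecLin_one]

theorem pushMap_surjective {p : X → Y} (hp : p.Surjective) :
    Function.Surjective (pushMap p) := by
  classical
  have := Fintype.ofSurjective p hp
  have h : pushMap p ∘ₗ pushMap (Function.surjInv hp) = LinearMap.id := by
    rw [← pushMap_comp, (Function.rightInverse_surjInv hp).comp_eq_id, pushMap_id]
  exact Function.RightInverse.surjective (LinearMap.congr_fun h)

theorem pullMap_injective [Finite Y] {p : Y → X} (hp : p.Surjective) :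
    Function.Injective (pullMap p) := by
  classical
  have := Fintype.ofFinite Y
  have h : pullMap (Function.surjInv hp) ∘ₗ pullMap p = LinearMap.id := by
    rw [← pullMap_comp, (Function.rightInverse_surjInv hp).comp_eq_id, pullMap_id]
  exact Function.LeftInverse.injective (g := pullMap (Function.surjInv hp)) (LinearMap.congr_fun h)

theorem pullMap_comp_pushMap_equiv [Fintype Y] [DecidableEq Y] (θ : X ≃ Y) :
    pullMap θ ∘ₗ pushMap θ = LinearMap.id := by
  rw [pullMap, pushMap, ← Matrix.mulVecLin_mul, labelMatrix_equiv_transpose true false,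
    labelMatrix_mul, θ.symm_comp_self, labelMatrix_id, Matrix.mulVecLin_one]

theorem ker_pushMap_mono {p : X → Y} {q : X → Z} (hp : p.Surjective)
    (h : Setoid.ker p ≤ Setoid.ker q) :
    LinearMap.ker (pushMap p) ≤ LinearMap.ker (pushMap q) := by
  classical
  have := Fintype.ofSurjective p hp
  have hq : q = (q ∘ Function.surjInv hp) ∘ p :=
    funext fun a => h (Function.surjInv_eq hp (p a)).symm
  rw [hq, pushMap_comp]
  exact LinearMap.ker_le_ker_comp _ _

/-- The kernel of the map that multiplies the tensor factors of `V^{⊗ X}` along the classes of an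
equivalence relation. -/
noncomputable def mergeKernel (R : Setoid X) : Submodule ℤ ((X → Bool) → ℤ) :=
  LinearMap.ker (pushMap (Quotient.mk R))

theorem ker_pushMap {p : X → Y} (hp : p.Surjective) :
    LinearMap.ker (pushMap p) = mergeKernel (Setoid.ker p) :=
  le_antisymm (ker_pushMap_mono hp (Setoid.ker_mk_eq _).ge)
    (ker_pushMap_mono Quotient.mk_surjective (Setoid.ker_mk_eq _).le)

theorem comap_pushMap_mergeKernel [Fintype Y] [DecidableEq Y] {p : X → Y} (hp : p.Surjective)
    (S : Setoid Y) : (mergeKernel S).comap (pushMap p) = mergeKernel (S.comap p) := by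
  rw [mergeKernel, ← LinearMap.ker_comp, ← pushMap_comp,
    ker_pushMap (Quotient.mk_surjective.comp hp)]
  congr 1
  exact Setoid.ext fun _ _ => Quotient.eq

end PushPull

theorem nonempty_comap_quotient_equiv {R M N : Type*} [Ring R] [AddCommGroup M] [AddCommGroup N]
    [Module R M] [Module R N] (f : M →ₗ[R] N) {K : Submodule R N} (L : Submodule R N)
    (hK : K ≤ LinearMap.range f) :
    Nonempty ((K.comap f ⧸ (L.comap f).submoduleOf (K.comap f)) ≃ₗ[R] (K ⧸ L.submoduleOf K)) := by
  let g : K.comap f →ₗ[R] K := f.restrict fun _ h => h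
  have hg : Function.Surjective ((L.submoduleOf K).mkQ ∘ₗ g) := by
    refine (Submodule.mkQ_surjective _).comp fun y => ?_
    obtain ⟨x, hx⟩ := hK y.2
    exact ⟨⟨x, by rw [Submodule.mem_comap, hx]; exact y.2⟩, Subtype.ext hx⟩
  refine ⟨(Submodule.quotEquivOfEq _ _ ?_).trans (LinearMap.quotKerEquivOfSurjective _ hg)⟩
  rw [LinearMap.ker_comp, Submodule.ker_mkQ]
  rfl

namespace LinkDiagram

variable {D : LinkDiagram}

section Transfer

variable {s t u : D.State} {k : Fin D.n}

/-- If every circle of `tD` is a union of circles of `sD`, the map that sends a circle of `sD` to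
the circle of `tD` that contains it. -/
def transfer (h : D.circleSetoid s ≤ D.circleSetoid t) : D.Circle s → D.Circle t :=
  Sum.map (Quotient.map id fun _ _ hab => h hab) id

theorem transfer_circleOf (h : D.circleSetoid s ≤ D.circleSetoid t) (a : D.HalfEdge) :
    transfer h (D.circleOf s a) = D.circleOf t a := rfl

theorem transfer_surjective (h : D.circleSetoid s ≤ D.circleSetoid t) :
    Function.Surjective (transfer h) :=
  (Quotient.map_surjective _ Function.surjective_id).sumMap Function.surjective_id

theorem transfer_comp (hst : D.circleSetoid s ≤ D.circleSetoid t)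
    (htu : D.circleSetoid t ≤ D.circleSetoid u) :
    transfer htu ∘ transfer hst = transfer (hst.trans htu) := by
  funext x
  rcases x with ⟨⟨a⟩⟩ | i <;> rfl

theorem map_transfer_chord (h : D.circleSetoid s ≤ D.circleSetoid t) (k : Fin D.n) :
    (D.chord s k).map (transfer h) = D.chord t k := rfl

theorem circleSetoid_le_of_isDiag (hst : Set.EqOn s t {k}ᶜ) (ht : (D.chord t k).IsDiag) :
    D.circleSetoid s ≤ D.circleSetoid t := by
  refine circleSetoid_le_iff.2 fun h => ⟨(circleSetoid_le_iff.1 le_rfl h).1, ?_⟩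
  rw [← circleOf_eq_iff]
  rcases eq_or_ne h.1 k with rfl | hk
  · exact eq_of_mem_of_isDiag ht (circleOf_mem_chord t _ _) (circleOf_mem_chord t _ _)
  · rw [smooth_congr (hst hk), circleOf_smooth]

theorem ker_transfer (hst : Set.EqOn s t {k}ᶜ) (ht : (D.chord t k).IsDiag)
    (h : D.circleSetoid s ≤ D.circleSetoid t) :
    Setoid.ker (transfer h) = endsSetoid (D.chord s k) := by
  have hle : D.circleSetoid t ≤ (endsSetoid (D.chord s k)).comap (D.circleOf s) := by
    refine circleSetoid_le_iff.2 fun a => ⟨.inl (circleOf_glue s a).symm, ?_⟩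
    rcases eq_or_ne a.1 k with rfl | hk
    · exact .inr ⟨circleOf_mem_chord s _ _, circleOf_mem_chord s _ _⟩
    · exact .inl (by rw [← smooth_congr (hst hk), circleOf_smooth])
  refine le_antisymm ?_ (endsSetoid_le_iff.2 fun a ha b hb => ?_)
  · rintro (⟨⟨a⟩⟩ | i) (⟨⟨b⟩⟩ | j) hab
    · exact hle (circleOf_eq_iff.1 hab)
    · exact absurd hab Sum.inl_ne_inr
    · exact absurd hab Sum.inr_ne_inl
    · exact .inl (congrArg _ (Sum.inr_injective hab))
  · rw [Setoid.ker_def]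
    refine eq_of_mem_of_isDiag (map_transfer_chord h k ▸ ht) ?_ ?_
    exacts [Sym2.mem_map.2 ⟨a, ha, rfl⟩, Sym2.mem_map.2 ⟨b, hb, rfl⟩]

end Transfer

section EdgeMap

variable {s t : D.State} {k : Fin D.n} {x : D.Labelling s} {y : D.Labelling t}

theorem mulCoeff_eq_ite : ∀ a b c : Bool, mulCoeff a b c =
    if ¬ (a = false ∧ b = false) ∧ (c = false ↔ a = false ∨ b = false) then 1 else 0 := by
  decide

theorem comulCoeff_eq_ite : ∀ a b c : Bool, comulCoeff c a b =
    if ¬ (a = true ∧ b = true) ∧ (c = true ↔ a = true ∨ b = true) then 1 else 0 := by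
  decide

theorem agreeAway_iff_of_le (h : D.circleSetoid s ≤ D.circleSetoid t) :
    D.AgreeAway s t k x y ↔ ∀ a, a ≠ D.circleOf s (k, 0) → a ≠ D.circleOf s (k, 2) →
      x a = y (transfer h a) := by
  rw [AgreeAway, and_comm, Sum.forall, Quotient.forall]
  exact and_congr Iff.rfl (forall_congr' fun i => by simp [circleOf, transfer])

theorem edgeMap_eq_pushMap (hst : Set.EqOn s t {k}ᶜ) (hs : ¬ (D.chord s k).IsDiag)
    (ht : (D.chord t k).IsDiag) (h : D.circleSetoid s ≤ D.circleSetoid t) :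
    D.edgeMap s t k = pushMap (transfer h) := by
  classical
  rw [edgeMap, pushMap]
  congr 1
  ext y x
  rw [isDiag_chord_iff] at hs
  rw [Matrix.of_apply, edgeCoeff, agreeAway_iff_of_le h, if_pos hs, mulCoeff_eq_ite,
    labelMatrix_merge (transfer_surjective h) (ker_transfer hst ht h) hs, transfer_circleOf]

theorem agreeAway_iff_of_ge (hst : Set.EqOn s t {k}ᶜ) (hs : (D.chord s k).IsDiag)
    (h : D.circleSetoid t ≤ D.circleSetoid s) :
    D.AgreeAway s t k x y ↔ ∀ a, a ≠ D.circleOf t (k, 0) → a ≠ D.circleOf t (k, 2) →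
      y a = x (transfer h a) := by
  have hmem (a : D.HalfEdge) :
      D.circleOf s a = D.circleOf s (k, 0) ↔ D.circleOf t a ∈ D.chord t k := by
    rw [← transfer_circleOf h, ← transfer_circleOf h, ← Setoid.ker_def, ker_transfer hst.symm hs h,
      endsSetoid_iff_mem (circleOf_mem_chord t k 0)]
  rw [AgreeAway, and_comm, Sum.forall, Quotient.forall, ← isDiag_chord_iff.1 hs]
  refine and_congr (forall_congr' fun a => ?_) (forall_congr' fun i => ?_)
  · have := hmem a
    simp only [chord, Sym2.mem_iff] at this
    change _ ↔ (D.circleOf t a ≠ _ → D.circleOf t a ≠ _ → y (D.circleOf t a) = x (D.circleOf s a))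
    tauto
  · simp [circleOf, transfer, eq_comm]

theorem edgeMap_eq_pullMap (hst : Set.EqOn s t {k}ᶜ) (hs : (D.chord s k).IsDiag)
    (ht : ¬ (D.chord t k).IsDiag) (h : D.circleSetoid t ≤ D.circleSetoid s) :
    D.edgeMap s t k = pullMap (transfer h) := by
  classical
  rw [edgeMap, pullMap]
  congr 1
  ext y x
  rw [isDiag_chord_iff] at hs ht
  rw [Matrix.of_apply, edgeCoeff, agreeAway_iff_of_ge hst (isDiag_chord_iff.2 hs) h,
    if_neg (not_not.2 hs), comulCoeff_eq_ite, Matrix.transpose_apply,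
    labelMatrix_merge (transfer_surjective h) (ker_transfer hst.symm (isDiag_chord_iff.2 hs) h) ht,
    transfer_circleOf]

end EdgeMap

section Square

variable {s t u : D.State} {c d k : Fin D.n}

theorem circleSetoid_eq_comap (hst : Set.EqOn s t {k}ᶜ) (ht : (D.chord t k).IsDiag) :
    D.circleSetoid t = (endsSetoid (D.chord s k)).comap (D.circleOf s) := by
  rw [← ker_transfer hst ht (circleSetoid_le_of_isDiag hst ht)]
  exact Setoid.ext fun _ _ => circleOf_eq_iff.symm

/-- The identification of the circles of two resolutions that consist of the same circles. -/
def transferEquiv (h : D.circleSetoid s = D.circleSetoid t) : D.Circle s ≃ D.Circle t where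
  toFun := transfer h.le
  invFun := transfer h.ge
  left_inv x := by rcases x with ⟨⟨a⟩⟩ | i <;> rfl
  right_inv x := by rcases x with ⟨⟨a⟩⟩ | i <;> rfl

variable (D) in
/-- The edges of the cube of resolutions: `t` arises from `s` by changing the marker at `k` from `0`
to `1`. -/
def IsCubeEdge (s t : D.State) (k : Fin D.n) : Prop :=
  s k = false ∧ t = Function.update s k true

theorem IsCubeEdge.eqOn (h : D.IsCubeEdge s t k) : Set.EqOn s t {k}ᶜ := fun j hj => by
  rw [h.2, Function.update_of_ne hj]

theorem IsCubeEdge.ne (h : D.IsCubeEdge s t k) : s k ≠ t k := by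
  rw [h.1, h.2, Function.update_self]
  exact Bool.false_ne_true

theorem IsCubeEdge.isDiag_chord_iff (h : D.IsCubeEdge s t k) :
    (D.chord t k).IsDiag ↔ ¬ (D.chord s k).IsDiag :=
  isDiag_chord_iff_not_isDiag h.eqOn h.ne

theorem IsCubeEdge.circleSetoid_le (h : D.IsCubeEdge s t k) (hs : ¬ (D.chord s k).IsDiag) :
    D.circleSetoid s ≤ D.circleSetoid t :=
  circleSetoid_le_of_isDiag h.eqOn (h.isDiag_chord_iff.2 hs)

theorem IsCubeEdge.circleSetoid_ge (h : D.IsCubeEdge s t k) (hs : (D.chord s k).IsDiag) :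
    D.circleSetoid t ≤ D.circleSetoid s :=
  circleSetoid_le_of_isDiag h.eqOn.symm hs

theorem IsCubeEdge.ker_transfer (h : D.IsCubeEdge s t k) (hs : ¬ (D.chord s k).IsDiag) :
    Setoid.ker (transfer (h.circleSetoid_le hs)) = endsSetoid (D.chord s k) :=
  LinkDiagram.ker_transfer h.eqOn (h.isDiag_chord_iff.2 hs) _

theorem IsCubeEdge.edgeMap_eq_pushMap (h : D.IsCubeEdge s t k) (hs : ¬ (D.chord s k).IsDiag) :
    D.edgeMap s t k = pushMap (transfer (h.circleSetoid_le hs)) :=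
  LinkDiagram.edgeMap_eq_pushMap h.eqOn hs (h.isDiag_chord_iff.2 hs) _

theorem IsCubeEdge.edgeMap_eq_pullMap (h : D.IsCubeEdge s t k) (hs : (D.chord s k).IsDiag) :
    D.edgeMap s t k = pullMap (transfer (h.circleSetoid_ge hs)) :=
  LinkDiagram.edgeMap_eq_pullMap h.eqOn hs (mt h.isDiag_chord_iff.1 (not_not.2 hs)) _

theorem IsCubeEdge.isDiag_chord_iff_eq (h : D.IsCubeEdge s t c) (hc : ¬ (D.chord s c).IsDiag)
    (hd : ¬ (D.chord s d).IsDiag) : (D.chord t d).IsDiag ↔ D.chord s d = D.chord s c := by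
  rw [← map_transfer_chord (h.circleSetoid_le hc)]
  exact isDiag_map_iff (h.ker_transfer hc) hd

theorem ker_edgeMap (h : D.IsCubeEdge s t c) (hc : ¬ (D.chord s c).IsDiag) :
    LinearMap.ker (D.edgeMap s t c) = mergeKernel (endsSetoid (D.chord s c)) := by
  rw [h.edgeMap_eq_pushMap hc, ker_pushMap (transfer_surjective _), h.ker_transfer hc]

theorem ker_edgeMap_comp_edgeMap (hst : D.IsCubeEdge s t c) (htu : D.IsCubeEdge t u d)
    (hc : ¬ (D.chord s c).IsDiag) (hd : ¬ (D.chord s d).IsDiag) :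
    LinearMap.ker (D.edgeMap t u d ∘ₗ D.edgeMap s t c) =
      mergeKernel (endsSetoid (D.chord s c) ⊔ endsSetoid (D.chord s d)) := by
  by_cases hdiag : (D.chord t d).IsDiag
  · rw [htu.edgeMap_eq_pullMap hdiag,
      LinearMap.ker_comp_of_ker_eq_bot _ (LinearMap.ker_eq_bot.2 (pullMap_injective
        (transfer_surjective _))), ker_edgeMap hst hc,
      (hst.isDiag_chord_iff_eq hc hd).1 hdiag, sup_idem]
  · rw [LinearMap.ker_comp, ker_edgeMap htu hdiag, hst.edgeMap_eq_pushMap hc,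
      comap_pushMap_mergeKernel (transfer_surjective _), ← hst.ker_transfer hc,
      ← comap_endsSetoid_map, map_transfer_chord]

theorem edgeMap_comp_edgeMap_of_chord_eq {t₁ t₂ : D.State} (h₁ : D.IsCubeEdge s t₁ c)
    (h₁' : D.IsCubeEdge t₁ u d) (h₂ : D.IsCubeEdge s t₂ d) (h₂' : D.IsCubeEdge t₂ u c)
    (hc : ¬ (D.chord s c).IsDiag) (hd : ¬ (D.chord s d).IsDiag)
    (hcd : D.chord s d = D.chord s c) :
    D.edgeMap t₁ u d ∘ₗ D.edgeMap s t₁ c = D.edgeMap t₂ u c ∘ₗ D.edgeMap s t₂ d := by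
  have hdiag₁ := (h₁.isDiag_chord_iff_eq hc hd).2 hcd
  have hdiag₂ := (h₂.isDiag_chord_iff_eq hd hc).2 hcd.symm
  have heq : D.circleSetoid t₁ = D.circleSetoid t₂ := by
    rw [circleSetoid_eq_comap h₁.eqOn (h₁.isDiag_chord_iff.2 hc),
      circleSetoid_eq_comap h₂.eqOn (h₂.isDiag_chord_iff.2 hd), hcd]
  have hpull : pullMap (transfer heq.le) ∘ₗ pushMap (transfer heq.le) = LinearMap.id :=
    pullMap_comp_pushMap_equiv (transferEquiv heq)
  rw [h₁.edgeMap_eq_pushMap hc, h₂.edgeMap_eq_pushMap hd, h₁'.edgeMap_eq_pullMap hdiag₁,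
    h₂'.edgeMap_eq_pullMap hdiag₂, ← transfer_comp (h₁.circleSetoid_le hc) heq.le,
    ← transfer_comp (h₁'.circleSetoid_ge hdiag₁) heq.le, pushMap_comp, pullMap_comp,
    LinearMap.comp_assoc, ← LinearMap.comp_assoc _ (pushMap (transfer heq.le)), hpull,
    LinearMap.id_comp]

theorem edgeMap_comp_edgeMap {t₁ t₂ : D.State} (h₁ : D.IsCubeEdge s t₁ c)
    (h₁' : D.IsCubeEdge t₁ u d) (h₂ : D.IsCubeEdge s t₂ d) (h₂' : D.IsCubeEdge t₂ u c)
    (hc : ¬ (D.chord s c).IsDiag) (hd : ¬ (D.chord s d).IsDiag) :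
    D.edgeMap t₁ u d ∘ₗ D.edgeMap s t₁ c = D.edgeMap t₂ u c ∘ₗ D.edgeMap s t₂ d := by
  by_cases hcd : D.chord s d = D.chord s c
  · exact edgeMap_comp_edgeMap_of_chord_eq h₁ h₁' h₂ h₂' hc hd hcd
  · have hdiag₁ := mt (h₁.isDiag_chord_iff_eq hc hd).1 hcd
    have hdiag₂ := mt (h₂.isDiag_chord_iff_eq hd hc).1 (Ne.symm hcd)
    rw [h₁.edgeMap_eq_pushMap hc, h₂.edgeMap_eq_pushMap hd, h₁'.edgeMap_eq_pushMap hdiag₁,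
      h₂'.edgeMap_eq_pushMap hdiag₂, ← pushMap_comp, ← pushMap_comp, transfer_comp, transfer_comp]

end Square

section Differential

variable {s s' t : D.State} {k : Fin D.n} {r q : ℤ}

theorem IsCubeEdge.apply_eq_true (h : D.IsCubeEdge s t k) : t k = true := by
  rw [h.2, Function.update_self]

theorem IsCubeEdge.eq (h : D.IsCubeEdge s t k) (h' : D.IsCubeEdge s' t k) : s = s' := by
  funext j
  rcases eq_or_ne j k with rfl | hj
  exacts [h.1.trans h'.1.symm, (h.eqOn hj).trans (h'.eqOn hj).symm]

variable (D) in
/-- The state with marker `1` exactly at the crossings in `A`. -/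
def finsetState (A : Finset (Fin D.n)) : D.State := fun c => decide (c ∈ A)

theorem finsetState_filter (s : D.State) : D.finsetState {c | s c = true} = s := by
  funext c
  simp [finsetState]

theorem weight_finsetState (A : Finset (Fin D.n)) : D.weight (D.finsetState A) = A.card := by
  simp [weight, finsetState]

theorem exists_finsetState (s : D.StateOfWeight r) :
    ∃ A : Finset (Fin D.n), s.1 = D.finsetState A ∧ (A.card : ℤ) = r :=
  ⟨_, (finsetState_filter s.1).symm, s.2⟩

theorem isCubeEdge_finsetState {A : Finset (Fin D.n)} (hk : k ∉ A) :
    D.IsCubeEdge (D.finsetState A) (D.finsetState (insert k A)) k := by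
  refine ⟨decide_eq_false hk, funext fun j => ?_⟩
  rcases eq_or_ne j k with rfl | hj
  · simp [finsetState]
  · simp [finsetState, hj]

/-- The sign of the edge of the cube that starts at `s` and changes the marker at `k`. -/
def edgeSign (s : D.State) (k : Fin D.n) : ℤ :=
  (-1) ^ (Finset.univ.filter fun j => j < k ∧ s j = true).card

theorem edgeSign_zeroState (k : Fin D.n) : edgeSign D.zeroState k = 1 := by
  simp [edgeSign, zeroState]

theorem edgeSign_singleton (c : Fin D.n) :
    edgeSign (D.finsetState {c}) k = if c < k then -1 else 1 := by
  have : Finset.univ.filter (fun j => j < k ∧ D.finsetState {c} j = true) =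
      ({c} : Finset (Fin D.n)).filter (· < k) := by
    ext j
    simp [finsetState, and_comm]
  rw [edgeSign, this, Finset.filter_singleton]
  split_ifs <;> simp

open Classical in
theorem differential_apply (x : D.ChainGroup r) (t : D.StateOfWeight q) :
    D.differential r q x t = ∑ k : Fin D.n, ∑ s : D.StateOfWeight r,
      if D.IsCubeEdge s.1 t.1 k then edgeSign s.1 k • D.edgeMap s.1 t.1 k (x s) else 0 := by
  rw [Finset.sum_comm, differential, LinearMap.pi_apply, LinearMap.sum_apply]
  refine Finset.sum_congr rfl fun s _ => ?_
  rw [LinearMap.sum_apply]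
  refine Finset.sum_congr rfl fun k _ => ?_
  unfold IsCubeEdge
  split_ifs <;> rfl

open Classical in
theorem sum_isCubeEdge {M : Type*} [AddCommMonoid M] {s : D.StateOfWeight r} (t : D.State)
    (h : D.IsCubeEdge s.1 t k) (f : D.StateOfWeight r → M) :
    ∑ s : D.StateOfWeight r, (if D.IsCubeEdge s.1 t k then f s else 0) = f s := by
  rw [Fintype.sum_eq_single s, if_pos h]
  exact fun s' hs' => if_neg fun h' => hs' (Subtype.ext (h'.eq h))

theorem differential_apply_singleton {x : D.ChainGroup r} {s : D.StateOfWeight r}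
    {t : D.StateOfWeight q} {c : Fin D.n} (hs : s.1 = D.zeroState) (ht : t.1 = D.finsetState {c}) :
    D.differential r q x t = D.edgeMap s.1 t.1 c (x s) := by
  classical
  have h : D.IsCubeEdge s.1 t.1 c := by
    rw [hs, ht]
    exact isCubeEdge_finsetState (Finset.notMem_empty c)
  have hsign : edgeSign s.1 c = 1 := by rw [hs, edgeSign_zeroState]
  rw [differential_apply, Fintype.sum_eq_single c, sum_isCubeEdge _ h, hsign, one_smul]
  refine fun k hk => Finset.sum_eq_zero fun s _ => if_neg fun h => ?_
  simpa [ht, finsetState, hk] using h.apply_eq_true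

theorem differential_apply_pair {x : D.ChainGroup r} {s₁ s₂ : D.StateOfWeight r}
    {t : D.StateOfWeight q} {c d : Fin D.n} (hcd : c < d) (hc : s₁.1 = D.finsetState {c})
    (hd : s₂.1 = D.finsetState {d}) (ht : t.1 = D.finsetState {c, d}) :
    D.differential r q x t = D.edgeMap s₂.1 t.1 c (x s₂) - D.edgeMap s₁.1 t.1 d (x s₁) := by
  classical
  have h₁ : D.IsCubeEdge s₁.1 t.1 d := by
    rw [hc, ht, Finset.pair_comm]
    exact isCubeEdge_finsetState (Finset.notMem_singleton.2 hcd.ne')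
  have h₂ : D.IsCubeEdge s₂.1 t.1 c := by
    rw [hd, ht]
    exact isCubeEdge_finsetState (Finset.notMem_singleton.2 hcd.ne)
  have hsign₁ : edgeSign s₁.1 d = -1 := by rw [hc, edgeSign_singleton, if_pos hcd]
  have hsign₂ : edgeSign s₂.1 c = 1 := by rw [hd, edgeSign_singleton, if_neg hcd.not_gt]
  rw [differential_apply, Fintype.sum_eq_add c d hcd.ne, sum_isCubeEdge _ h₁, sum_isCubeEdge _ h₂,
    hsign₁, hsign₂, one_smul, neg_one_smul, sub_eq_add_neg]
  refine fun k hk => Finset.sum_eq_zero fun s _ => if_neg fun h => ?_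
  simpa [ht, finsetState, hk] using h.apply_eq_true

end Differential

end LinkDiagram

section ChromaticHomology

variable {X Y : Type*} [Fintype X] [DecidableEq X]

/-- The cocycles of degree one in the chromatic complex of the simple graph with vertex set `X` and
edge set `E`, over the algebra `V` of Khovanov homology. The component at `e` of a cochain lies in
the quotient of `V^{⊗ X}` by `mergeKernel (endsSetoid e)`; here the components are lifted
to `V^{⊗ X}`. -/
def compatibleFamilies (E : Set (Sym2 X)) : Submodule ℤ (E → (X → Bool) → ℤ) where
  carrier := {z | ∀ e f : E, z e - z f ∈ mergeKernel (endsSetoid e.1 ⊔ endsSetoid f.1)}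
  add_mem' hz hw e f := by
    rw [Pi.add_apply, Pi.add_apply, add_sub_add_comm]
    exact add_mem (hz e f) (hw e f)
  zero_mem' e f := by
    rw [Pi.zero_apply, Pi.zero_apply, sub_self]
    exact zero_mem _
  smul_mem' n z hz e f := by
    rw [Pi.smul_apply, Pi.smul_apply, ← smul_sub]
    exact Submodule.smul_mem _ n (hz e f)

/-- The coboundaries of degree one in the chromatic complex of the simple graph with vertex set `X`
and edge set `E`, lifted as in `compatibleFamilies`. -/
def constantFamilies (E : Set (Sym2 X)) : Submodule ℤ (E → (X → Bool) → ℤ) where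
  carrier := {z | ∃ a, ∀ e : E, z e - a ∈ mergeKernel (endsSetoid e.1)}
  add_mem' := by
    rintro z w ⟨a, ha⟩ ⟨b, hb⟩
    refine ⟨a + b, fun e => ?_⟩
    rw [Pi.add_apply, add_sub_add_comm]
    exact add_mem (ha e) (hb e)
  zero_mem' := ⟨0, fun e => by rw [Pi.zero_apply, sub_self]; exact zero_mem _⟩
  smul_mem' := by
    rintro n z ⟨a, ha⟩
    refine ⟨n • a, fun e => ?_⟩
    rw [Pi.smul_apply, ← smul_sub]
    exact Submodule.smul_mem _ n (ha e)

/-- The first chromatic homology group, in the sense of Helme-Guizon and Rong, of the simple graph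
with vertex set `X` and edge set `E`, over the algebra `ℤ[x] / (x²)`. -/
abbrev FirstChromaticHomology (E : Set (Sym2 X)) : Type _ :=
  compatibleFamilies E ⧸ (constantFamilies E).submoduleOf (compatibleFamilies E)

theorem pushMap_sub_pushMap_mem_mergeKernel_iff [Fintype Y] [DecidableEq Y] (θ : X ≃ Y)
    (S : Setoid Y) (v w : (X → Bool) → ℤ) :
    pushMap θ v - pushMap θ w ∈ mergeKernel S ↔ v - w ∈ mergeKernel (S.comap θ) := by
  rw [← map_sub, ← Submodule.mem_comap, comap_pushMap_mergeKernel θ.surjective]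

theorem nonempty_firstChromaticHomology_equiv [Fintype Y] [DecidableEq Y] (θ : X ≃ Y)
    {E : Set (Sym2 X)} {E' : Set (Sym2 Y)} (hE : ∀ e, e ∈ E ↔ e.map θ ∈ E') :
    Nonempty (FirstChromaticHomology E ≃ₗ[ℤ] FirstChromaticHomology E') := by
  let mapEquiv : Sym2 X ≃ Sym2 Y :=
    { toFun := Sym2.map θ
      invFun := Sym2.map θ.symm
      left_inv e := by rw [Sym2.map_map, θ.symm_comp_self, Sym2.map_id, id]
      right_inv e := by rw [Sym2.map_map, θ.self_comp_symm, Sym2.map_id, id] }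
  let σ : E ≃ E' := mapEquiv.subtypeEquiv hE
  let Ψ : (E → (X → Bool) → ℤ) →ₗ[ℤ] (E' → (Y → Bool) → ℤ) :=
    LinearMap.pi fun e => pushMap θ ∘ₗ LinearMap.proj (σ.symm e)
  have hΨ (z) (e : E) : Ψ z (σ e) = pushMap θ (z e) := by
    rw [← σ.symm_apply_apply e]
    simp [Ψ]
  have hends (e : E) : (endsSetoid (σ e).1).comap θ = endsSetoid e.1 :=
    comap_endsSetoid_map_equiv θ e.1
  have hsurj : Function.Surjective Ψ := fun w => by
    choose z hz using fun e => pushMap_surjective θ.surjective (w (σ e))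
    exact ⟨z, funext (σ.forall_congr_right.1 fun e => (hΨ z e).trans (hz e))⟩
  have hcompat : (compatibleFamilies E').comap Ψ = compatibleFamilies E := by
    ext z
    change (∀ e f, _ ∈ _) ↔ ∀ e f, _ ∈ _
    simp only [← σ.forall_congr_right, hΨ, pushMap_sub_pushMap_mem_mergeKernel_iff,
      comap_sup_equiv, hends]
  have hconst : (constantFamilies E').comap Ψ = constantFamilies E := by
    ext z
    change (∃ a, ∀ e, _ ∈ _) ↔ ∃ a, ∀ e, _ ∈ _
    simp only [(pushMap_surjective θ.surjective).exists, ← σ.forall_congr_right, hΨ,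
      pushMap_sub_pushMap_mem_mergeKernel_iff, hends]
  have h := nonempty_comap_quotient_equiv Ψ (constantFamilies E')
    (K := compatibleFamilies E') (by rw [LinearMap.range_eq_top.2 hsurj]; exact le_top)
  rwa [hcompat, hconst] at h

end ChromaticHomology

namespace LinkDiagram

section FirstHomology

variable {D : LinkDiagram}

/-- The state with marker `1` only at `c`. -/
def singleState (c : Fin D.n) : D.StateOfWeight 1 :=
  ⟨D.finsetState {c}, by rw [weight_finsetState, Finset.card_singleton, Nat.cast_one]⟩

theorem singleState_bijective : Function.Bijective (D.singleState) := by
  constructor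
  · intro c d h
    have h' := congrFun (congrArg Subtype.val h) c
    simpa [singleState, finsetState] using h'
  · intro s
    obtain ⟨A, hA, hcard⟩ := exists_finsetState s
    obtain ⟨c, rfl⟩ := Finset.card_eq_one.1 (Nat.cast_eq_one.1 hcard)
    exact ⟨c, Subtype.ext hA.symm⟩

theorem isCubeEdge_singleState (c : Fin D.n) :
    D.IsCubeEdge D.zeroState (D.singleState c).1 c :=
  isCubeEdge_finsetState (Finset.notMem_empty c)

/-- The component at the state `singleState c` of the differential from degree `0` to degree `1`. -/
noncomputable def firstEdgeMap (c : Fin D.n) :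
    D.VertexGroup D.zeroState →ₗ[ℤ] D.VertexGroup (D.singleState c).1 :=
  D.edgeMap D.zeroState (D.singleState c).1 c

theorem ker_firstEdgeMap (hD : D.IsZeroAdequate) (c : Fin D.n) :
    LinearMap.ker (D.firstEdgeMap c) = mergeKernel (endsSetoid (D.chord D.zeroState c)) :=
  ker_edgeMap (isCubeEdge_singleState c) (hD c)

theorem firstEdgeMap_eq_iff (hD : D.IsZeroAdequate) {c : Fin D.n}
    {v w : D.VertexGroup D.zeroState} : D.firstEdgeMap c v = D.firstEdgeMap c w ↔
      v - w ∈ mergeKernel (endsSetoid (D.chord D.zeroState c)) := by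
  rw [← ker_firstEdgeMap hD, LinearMap.sub_mem_ker_iff]

theorem firstEdgeMap_surjective (hD : D.IsZeroAdequate) (c : Fin D.n) :
    Function.Surjective (D.firstEdgeMap c) := by
  rw [firstEdgeMap, (isCubeEdge_singleState c).edgeMap_eq_pushMap (hD c)]
  exact pushMap_surjective (transfer_surjective _)

theorem differential_apply_pair_eq_zero_iff (hD : D.IsZeroAdequate) {q : ℤ} {x : D.ChainGroup 1}
    {t : D.StateOfWeight q} {c d : Fin D.n} (hcd : c < d) (ht : t.1 = D.finsetState {c, d})
    {v w : D.VertexGroup D.zeroState} (hv : x (D.singleState c) = D.firstEdgeMap c v)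
    (hw : x (D.singleState d) = D.firstEdgeMap d w) :
    D.differential 1 q x t = 0 ↔ v - w ∈ mergeKernel
      (endsSetoid (D.chord D.zeroState c) ⊔ endsSetoid (D.chord D.zeroState d)) := by
  have hc : D.IsCubeEdge (D.singleState c).1 t.1 d := by
    rw [ht, Finset.pair_comm]
    exact isCubeEdge_finsetState (Finset.notMem_singleton.2 hcd.ne')
  have hd : D.IsCubeEdge (D.singleState d).1 t.1 c := by
    rw [ht]
    exact isCubeEdge_finsetState (Finset.notMem_singleton.2 hcd.ne)
  have hcomm := LinearMap.congr_fun (edgeMap_comp_edgeMap (isCubeEdge_singleState c) hc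
    (isCubeEdge_singleState d) hd (hD c) (hD d)) w
  rw [differential_apply_pair (s₁ := D.singleState c) (s₂ := D.singleState d) hcd rfl rfl ht,
    hv, hw, sub_eq_zero, eq_comm,
    ← ker_edgeMap_comp_edgeMap (isCubeEdge_singleState c) hc (hD c) (hD d),
    LinearMap.sub_mem_ker_iff, hcomm]
  rfl

theorem mem_ker_differential_one_iff (hD : D.IsZeroAdequate) {x : D.ChainGroup 1}
    {w : Fin D.n → D.VertexGroup D.zeroState}
    (hx : ∀ c, x (D.singleState c) = D.firstEdgeMap c (w c)) :
    x ∈ LinearMap.ker (D.differential 1 (1 + 1)) ↔ ∀ c d, w c - w d ∈ mergeKernel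
      (endsSetoid (D.chord D.zeroState c) ⊔ endsSetoid (D.chord D.zeroState d)) := by
  rw [LinearMap.mem_ker]
  constructor
  · intro h
    have hlt (c d : Fin D.n) (hcd : c < d) := by
      let t : D.StateOfWeight (1 + 1) :=
        ⟨D.finsetState {c, d}, by rw [weight_finsetState, Finset.card_pair hcd.ne]; rfl⟩
      exact (differential_apply_pair_eq_zero_iff hD hcd (t := t) rfl (hx c) (hx d)).1 (congrFun h t)
    intro c d
    rcases lt_trichotomy c d with hcd | rfl | hdc
    · exact hlt c d hcd
    · rw [sub_self]
      exact zero_mem _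
    · rw [← neg_sub, sup_comm]
      exact neg_mem (hlt d c hdc)
  · refine fun h => funext fun t => ?_
    obtain ⟨A, hA, hcard⟩ := exists_finsetState t
    obtain ⟨c, d, hne, rfl⟩ := Finset.card_eq_two.1 (by exact_mod_cast hcard : A.card = 2)
    rcases hne.lt_or_gt with hcd | hdc
    · exact (differential_apply_pair_eq_zero_iff hD hcd hA (hx c) (hx d)).2 (h c d)
    · rw [Finset.pair_comm] at hA
      exact (differential_apply_pair_eq_zero_iff hD hdc hA (hx d) (hx c)).2 (h d c)

theorem mem_range_differential_zero_iff {x : D.ChainGroup 1} :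
    x ∈ LinearMap.range (D.differential (1 - 1) 1) ↔
      ∃ a, ∀ c, x (D.singleState c) = D.firstEdgeMap c a := by
  let s₀ : D.StateOfWeight (1 - 1) := ⟨D.zeroState, by simp [weight, zeroState]⟩
  have happly (y) (c) : D.differential (1 - 1) 1 y (D.singleState c) = D.firstEdgeMap c (y s₀) :=
    differential_apply_singleton (s := s₀) (t := D.singleState c) rfl rfl
  constructor
  · rintro ⟨y, rfl⟩
    exact ⟨y s₀, happly y⟩
  · rintro ⟨a, ha⟩
    refine ⟨Pi.single s₀ a, funext (singleState_bijective.2.forall.2 fun c => ?_)⟩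
    rw [happly, Pi.single_eq_same, ha]

variable (D) in
/-- The chain of degree one that a family indexed by the edges of `G₀(D)^{red}` induces through the
maps of the edges of the cube. -/
noncomputable def familyToChain :
    (Set.range (D.chord D.zeroState) → D.VertexGroup D.zeroState) →ₗ[ℤ] D.ChainGroup 1 :=
  let crossing := (Equiv.ofBijective D.singleState singleState_bijective).symm
  LinearMap.pi fun s => D.edgeMap D.zeroState s.1 (crossing s) ∘ₗ
    LinearMap.proj ⟨D.chord D.zeroState (crossing s), Set.mem_range_self _⟩

theorem familyToChain_apply (z : Set.range (D.chord D.zeroState) → D.VertexGroup D.zeroState)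
    (c : Fin D.n) : D.familyToChain z (D.singleState c) =
      D.firstEdgeMap c (z ⟨D.chord D.zeroState c, Set.mem_range_self c⟩) := by
  have h : (Equiv.ofBijective D.singleState singleState_bijective).symm (D.singleState c) = c :=
    Equiv.ofBijective_symm_apply_apply _ _ _
  simp only [familyToChain, LinearMap.pi_apply, h]
  rfl

-- Parallel crossings have edge maps with the same kernel, so a cycle has lifts to the vertex group
-- of the state `0` that depend only on the chords.
theorem ker_differential_le_range_familyToChain (hD : D.IsZeroAdequate) :
    LinearMap.ker (D.differential 1 (1 + 1)) ≤ LinearMap.range D.familyToChain := by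
  intro x hx
  choose w hw using fun c => firstEdgeMap_surjective hD c (x (D.singleState c))
  choose crossing hcrossing using fun e : Set.range (D.chord D.zeroState) => e.2
  refine ⟨w ∘ crossing, funext (singleState_bijective.2.forall.2 fun c => ?_)⟩
  rw [familyToChain_apply, ← hw c, firstEdgeMap_eq_iff hD]
  have h := (mem_ker_differential_one_iff hD fun c => (hw c).symm).1 hx
    (crossing ⟨D.chord D.zeroState c, Set.mem_range_self c⟩) c
  rwa [hcrossing, sup_idem] at h

theorem comap_familyToChain_ker (hD : D.IsZeroAdequate) :
    (LinearMap.ker (D.differential 1 (1 + 1))).comap D.familyToChain =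
      compatibleFamilies (Set.range (D.chord D.zeroState)) := by
  ext z
  rw [Submodule.mem_comap, mem_ker_differential_one_iff hD (familyToChain_apply z)]
  change _ ↔ ∀ e f, _ ∈ _
  simp only [Set.forall_subtype_range_iff]

theorem comap_familyToChain_range (hD : D.IsZeroAdequate) :
    (LinearMap.range (D.differential (1 - 1) 1)).comap D.familyToChain =
      constantFamilies (Set.range (D.chord D.zeroState)) := by
  ext z
  rw [Submodule.mem_comap, mem_range_differential_zero_iff]
  change _ ↔ ∃ a, ∀ e, _ ∈ _
  simp only [Set.forall_subtype_range_iff, familyToChain_apply, firstEdgeMap_eq_iff hD]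

theorem IsZeroAdequate.nonempty_unshiftedHomology_equiv (hD : D.IsZeroAdequate) :
    Nonempty (FirstChromaticHomology (Set.range (D.chord D.zeroState)) ≃ₗ[ℤ]
      D.UnshiftedHomology 1) := by
  have h := nonempty_comap_quotient_equiv D.familyToChain
    (LinearMap.range (D.differential (1 - 1) 1)) (ker_differential_le_range_familyToChain hD)
  rwa [comap_familyToChain_ker hD, comap_familyToChain_range hD] at h

end FirstHomology

theorem stateGraph_adj_iff {D : LinkDiagram} {x y : D.Circle D.zeroState} :
    (D.stateGraph D.zeroState).Adj x y ↔ s(x, y) ∈ Set.range (D.chord D.zeroState) :=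
  exists_congr fun _ => eq_comm

theorem exists_equiv_adj_iff {D D' : LinkDiagram}
    (ψ : Graph.MultiIso (D'.stateGraph D'.zeroState) (D.stateGraph D.zeroState).reduced) :
    ∃ θ : D.Circle D.zeroState ≃ D'.Circle D'.zeroState, ∀ x y,
      (D.stateGraph D.zeroState).Adj x y ↔ (D'.stateGraph D'.zeroState).Adj (θ x) (θ y) := by
  have hv : ∀ x, x ∈ (D.stateGraph D.zeroState).reduced.vertexSet := Set.mem_univ
  have hv' : ∀ x, x ∈ (D'.stateGraph D'.zeroState).vertexSet := Set.mem_univ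
  let θ : D.Circle D.zeroState ≃ D'.Circle D'.zeroState :=
    ((Equiv.subtypeUnivEquiv hv).symm.trans ψ.vertexEquiv.symm).trans (Equiv.subtypeUnivEquiv hv')
  have hθ (x) : ψ.vertexEquiv ⟨θ x, hv' _⟩ = ⟨x, hv x⟩ := ψ.vertexEquiv.apply_symm_apply _
  refine ⟨θ, fun x y => ⟨fun h => ?_, fun ⟨c, hc⟩ => ?_⟩⟩
  · have hl : (D.stateGraph D.zeroState).reduced.IsLink s(x, y) x y := ⟨rfl, h⟩
    obtain ⟨e, he⟩ := ψ.edgeEquiv.surjective ⟨s(x, y), hl.edge_mem⟩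
    exact ⟨e.1, (ψ.isLink_iff e ⟨θ x, hv' _⟩ ⟨θ y, hv' _⟩).2 (by rw [he, hθ, hθ]; exact hl)⟩
  · have h := (ψ.isLink_iff ⟨c, hc.edge_mem⟩ ⟨θ x, hv' _⟩ ⟨θ y, hv' _⟩).1 hc
    rw [hθ, hθ] at h
    exact h.2

theorem IsPositive.one_sub_numNegative {D : LinkDiagram} (hD : D.IsPositive) :
    (1 : ℤ) - D.numNegative = 1 := by
  simp [numNegative, hD _]

end LinkDiagram

theorem theorem4p1_general (D D' : LinkDiagram) (hD : D.IsZeroAdequate) (hD' : D'.IsZeroAdequate)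
    (θ : D.Circle D.zeroState ≃ D'.Circle D'.zeroState)
    (hθ : ∀ x y, (D.stateGraph D.zeroState).Adj x y ↔
      (D'.stateGraph D'.zeroState).Adj (θ x) (θ y)) :
    Nonempty (D.Kh (1 - D.numNegative) ≃+ D'.Kh (1 - D'.numNegative)) := by
  unfold LinkDiagram.Kh
  rw [sub_add_cancel, sub_add_cancel]
  obtain ⟨Φ⟩ := hD.nonempty_unshiftedHomology_equiv
  obtain ⟨Φ'⟩ := hD'.nonempty_unshiftedHomology_equiv
  have hchord (e) : e ∈ Set.range (D.chord D.zeroState) ↔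
      e.map θ ∈ Set.range (D'.chord D'.zeroState) := by
    induction e with
    | _ x y => rw [Sym2.map_mk, ← LinkDiagram.stateGraph_adj_iff, hθ,
        LinkDiagram.stateGraph_adj_iff]
  obtain ⟨Θ⟩ := nonempty_firstChromaticHomology_equiv θ hchord
  exact ⟨((Φ.symm.trans Θ).trans Φ').toAddEquiv⟩

theorem theorem4p1 (D D' : LinkDiagram)
    (hred : D.IsReduced) (hpos : D.IsPositive) (hpos' : D'.IsPositive)
    (hgraph : Nonempty (Graph.MultiIso (D'.stateGraph D'.zeroState)
      (D.stateGraph D.zeroState).reduced)) :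
    Nonempty (D.Kh 1 ≃+ D'.Kh 1) := by
  obtain ⟨θ, hθ⟩ := LinkDiagram.exists_equiv_adj_iff hgraph.some
  have h := theorem4p1_general D D' hpos.isZeroAdequate hpos'.isZeroAdequate θ hθ
  rwa [hpos.one_sub_numNegative, hpos'.one_sub_numNegative] at h
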